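/- All languages are subsets of $\{0,1\}^*$. Put $\mathrm{BH}_1=\mathrm{NP}$ and, for $k>1$, $\mathrm{BH}_k=\{A\setminus B : A\in\mathrm{NP},\ B\in\mathrm{BH}_{k-1}\}$. For language classes $\mathcal C_1,\mathcal C_2$, let $\mathrm{P}^{\mathcal C_1[1]:\mathcal C_2[1]}$ be the class of languages accepted by deterministic polynomial-time oracle machines that make (at most) one query to an oracle $A\in\mathcal C_1$ followed by (at most) one query to an oracle $B\in\mathcal C_2$; the polynomial time bound and the restriction on the queries hold for all oracles. For $m\ge 1$, let $\mathrm{R}^{p}_{m\text{-tt}}(\mathrm{NP})$ be the class of languages $L$ for which there are $C\in\mathrm{NP}$ and a polynomial-time computable function that, on each input $x$, computes $m$ strings $x_1,\dots,x_m$ and a predicate $\alpha$ of $m$ boolean variables such that $x\in L \iff \alpha(\chi_C(x_1),\dots,\chi_C(x_m))$, where $\chi_C$ is the characteristic function of $C$. **Theorem 3.6.** For all integers $j,k\ge 1$, $$\mathrm{P}^{\mathrm{BH}_j[1]:\mathrm{BH}_k[1]}=\begin{cases}\mathrm{R}^{p}_{(j+2k-1)\text{-tt}}(\mathrm{NP})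 & \text{if } j \text{ is even and } k \text{ is odd},\\ \mathrm{R}^{p}_{(j+2k)\text{-tt}}(\mathrm{NP}) & \text{otherwise.}\end{cases}$$ -/

import Mathlib

/-!
# Query order in the boolean hierarchy: machines and classes

All strings are binary.  One machine model serves for polynomial-time computable functions, for NP
and for oracle access: a finite control working on finitely many stacks of bits (a multi-stack
Turing machine; a tape is a pair of stacks).  Every instruction costs one step.
-/

namespace QueryOrder

/-- The instruction attached to a control state.  `ι` names the available oracles, `K` the stacks
and `Q` the control states. -/
inductive Instr (ι K Q : Type) : Type
  /-- Push the bit `b` on stack `k`. -/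
  | push (k : K) (b : Bool) (next : Q)
  /-- Remove the top bit of stack `k` and branch on it (`none`: the stack is empty). -/
  | pop (k : K) (next : Option Bool → Q)
  /-- A nondeterministic binary choice. -/
  | guess (next : Bool → Q)
  /-- Ask oracle `i` about the string on stack `k` (read from the top) and branch on the answer. -/
  | query (i : ι) (k : K) (next : Bool → Q)
  /-- Stop, and accept (`true`) or reject (`false`). -/
  | halt (verdict : Bool)

/-- A (possibly nondeterministic) machine with oracles named by `ι`. -/
structure Machine (ι : Type) : Type 1 where
  /-- control states -/
  Q : Type
  /-- stacks -/
  K : Type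
  [finQ : Fintype Q]
  [finK : Fintype K]
  [decK : DecidableEq K]
  /-- initial state -/
  start : Q
  /-- the stack that initially holds the input -/
  inp : K
  /-- the stack that holds the output when the machine halts -/
  out : K
  /-- the program -/
  instr : Q → Instr ι K Q

attribute [instance] Machine.finQ Machine.finK Machine.decK

namespace Machine

variable {ι : Type} (M : Machine ι)

/-- Configurations.  `coins` are the outcomes of the nondeterministic choices still to be made;
`asked` records, in chronological order, which oracles have been queried so far. -/
structure Cfg where
  /-- current state -/
  state : M.Q
  /-- stack contents, top first -/
  stk : M.K → List Bool
  /-- outcomes of future choices -/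
  coins : ℕ → Bool
  /-- oracles queried so far -/
  asked : List ι

/-- The initial configuration on input `x`. -/
def init (coins : ℕ → Bool) (x : List Bool) : M.Cfg where
  state := M.start
  stk := Function.update (fun _ => []) M.inp x
  coins := coins
  asked := []

open scoped Classical in
/-- One step of computation with oracles `O`; a halted machine stays where it is. -/
noncomputable def step (O : ι → Language Bool) (c : M.Cfg) : M.Cfg :=
  match M.instr c.state with
  | .push k b q => { c with state := q, stk := Function.update c.stk k (b :: c.stk k) }
  | .pop k next =>
      { c with state := next (c.stk k).head?, stk := Function.update c.stk k (c.stk k).tail }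
  | .guess next => { c with state := next (c.coins 0), coins := fun n => c.coins (n + 1) }
  | .query i k next =>
      { c with state := next (decide (c.stk k ∈ O i)), asked := c.asked ++ [i] }
  | .halt _ => c

/-- The configuration reached from input `x` after `t` steps. -/
noncomputable def run (O : ι → Language Bool) (coins : ℕ → Bool) (x : List Bool) (t : ℕ) : M.Cfg :=
  (M.step O)^[t] (M.init coins x)

/-- The machine never makes a nondeterministic choice. -/
def Deterministic : Prop :=
  ∀ q next, M.instr q ≠ .guess next

/-- Some polynomial in the input length bounds the number of steps before halting, on every
computation path and whatever the oracles are. -/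
def PolyTime : Prop :=
  ∃ p : Polynomial ℕ, ∀ (O : ι → Language Bool) (coins : ℕ → Bool) (x : List Bool),
    ∃ t ≤ p.eval x.length, ∃ b, M.instr (M.run O coins x t).state = .halt b

/-- Some computation path on input `x` accepts (for a deterministic machine there is only one
path). -/
def Accepts (O : ι → Language Bool) (x : List Bool) : Prop :=
  ∃ coins t, M.instr (M.run O coins x t).state = .halt true

end Machine

/-- `f` is computed by a deterministic polynomial-time machine (without oracles). -/
def PolyTimeComputable (f : List Bool → List Bool) : Prop :=
  ∃ M : Machine Empty, M.Deterministic ∧ M.PolyTime ∧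
    ∀ (coins : ℕ → Bool) (x : List Bool), ∃ t b,
      M.instr (M.run Empty.elim coins x t).state = .halt b ∧
        (M.run Empty.elim coins x t).stk M.out = f x

/-- Nondeterministic polynomial time. -/
def NP : Set (Language Bool) :=
  {L | ∃ M : Machine Empty, M.PolyTime ∧ ∀ x, x ∈ L ↔ M.Accepts Empty.elim x}

/-- `C₁ ⊖ C₂`: all differences of a language in `C₁` and a language in `C₂`. -/
def classDiff (C₁ C₂ : Set (Language Bool)) : Set (Language Bool) :=
  {L | ∃ A ∈ C₁, ∃ B ∈ C₂, L = A \ B}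

/-- The levels of the boolean hierarchy over NP: `BH 1 = NP` and `BH k = NP ⊖ BH (k - 1)` for
`k > 1`.  (Level `0` is a convention and not a level of the hierarchy.) -/
def BH : ℕ → Set (Language Bool)
  | 0 => {⊥}
  | 1 => NP
  | k + 2 => classDiff NP (BH (k + 1))

/-- `P^{C₁[1]:C₂[1]}`: the languages accepted by a deterministic polynomial-time oracle machine that
makes one query to an oracle in `C₁` (oracle `0`) followed by one query to an oracle in `C₂`
(oracle `1`).  On each run each oracle is queried at most once, and oracle `0` is not queried after
oracle `1`. -/
def POneOne (C₁ C₂ : Set (Language Bool)) : Set (Language Bool) :=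
  {L | ∃ A ∈ C₁, ∃ B ∈ C₂, ∃ M : Machine (Fin 2), M.Deterministic ∧ M.PolyTime ∧
    (∀ O coins x t, (M.run O coins x t).asked.Sublist [0, 1]) ∧
    ∀ x, x ∈ L ↔ M.Accepts ![A, B] x}

/-- Self-delimiting code of a pair of strings: every bit of `x` is preceded by a `1`, then come a
`0` and the string `y`. -/
def pair (x y : List Bool) : List Bool :=
  x.flatMap (fun b => [true, b]) ++ false :: y

/-- The truth table of an `m`-ary predicate as a string of `2 ^ m` bits: bit number `n` is the value
at the assignment given by the binary digits of `n`. -/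
def truthTable {m : ℕ} (α : (Fin m → Bool) → Bool) : List Bool :=
  List.ofFn fun n : Fin (2 ^ m) => α fun i => (n : ℕ).testBit i

/-- The code of `m` strings together with an `m`-ary predicate, as one string. -/
def encodeTT {m : ℕ} (y : Fin m → List Bool) (α : (Fin m → Bool) → Bool) : List Bool :=
  (List.ofFn y).foldr pair (truthTable α)

open scoped Classical in
/-- `A` is polynomial-time `m`-truth-table reducible to `B`: in polynomial time one computes from
`x` strings `y x 0, …, y x (m - 1)` and a predicate `α x` of `m` boolean variables with
`x ∈ A ↔ α x (χ_B (y x 0), …, χ_B (y x (m - 1)))`. -/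
def TTReducible (m : ℕ) (A B : Language Bool) : Prop :=
  ∃ (y : List Bool → Fin m → List Bool) (α : List Bool → (Fin m → Bool) → Bool),
    PolyTimeComputable (fun x => encodeTT (y x) (α x)) ∧
    ∀ x, x ∈ A ↔ α x (fun i => decide (y x i ∈ B)) = true

/-- `R_{m-tt}^p(C)`: the languages `m`-truth-table reducible to some language in `C`. -/
def RTT (m : ℕ) (C : Set (Language Bool)) : Set (Language Bool) :=
  {L | ∃ B ∈ C, TTReducible m L B}

end QueryOrder

/-! Both classes are compared with one normal form, `MindChanges m`: a polynomial-time initial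
guess, reversed `N x` times, where `N ≤ m` and every set `{x | c < N x}` is in NP (`NPRank`).

Truth tables. From the normal form, the `m` queries "is `c < N x`?" for `c < m` reveal `N x` by
counting (`MindChanges.mem_RTT`). Conversely, the vector of answers lies in the finite poset
`{0,1}^m`, and the set of points below it is known in the NP sense. The maximal number of value
changes of the predicate along a chain from `⊥` up to that vector is at most `m`, has superlevel
sets in NP, and its parity compares the final value with the value at `⊥`
(`MindChanges.of_alternation`, `MindChanges.of_RTT`).

Two queries. A language is in `BH k` exactly if membership is the parity of an NP rank bounded by
`k` (`mem_BH_iff`). So the outcome of a two-query machine depends on three ranks: `a ≤ j` for the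
first query, and `b, b' ≤ k` for the second query asked after the answer no or yes. Chains of such
triples have at most `j + 2k` steps, hence at most that many mind changes. If `j` is even and `k` is
odd, this bound is missed: `j + 2k` changes would end at the top, where the answers are no and yes;
as `j + 2k` is even, the outcome after no, yes would equal that after no, no. Then `b` would be
irrelevant and only `j + k` changes possible (`alternates_outcome_le_of_even_odd`).

Conversely, let a counter `N` spend its first `k` increments on `b`, an odd number `i ≤ j` on `a`,
and `k` more on `b'` (`MindChanges.mem_POneOne_of_odd`). This is optimal for odd `j`. For even `j`
one takes `i = j - 1`; if `k` is even too, one further change is gained by finally raising `a` to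
`j`, which switches back to `b`, whose rank `k` is even (`MindChanges.mem_POneOne_of_even`).

The rest is programming: a small calculus of flow charts with time bounds, which yields the needed
machines and the closure properties of NP. -/

namespace QueryOrder

open Function

/-! ### Program fragments, their semantics and their composition -/

namespace Instr

variable {ι ι' K K' Q Q' : Type}

/-- Rename oracles, stacks and states. -/
def map (i : ι → ι') (f : K → K') (g : Q → Q') : Instr ι K Q → Instr ι' K' Q'
  | .push k b q => .push (f k) b (g q)
  | .pop k n => .pop (f k) fun o => g (n o)
  | .guess n => .guess fun b => g (n b)
  | .query a k n => .query (i a) (f k) fun b => g (n b)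
  | .halt b => .halt b

/-- The instruction is a nondeterministic choice. -/
def IsGuess : Instr ι K Q → Prop
  | .guess _ => True
  | _ => False

theorem isGuess_map (i : ι → ι') (f : K → K') (g : Q → Q') (c : Instr ι K Q) :
    (c.map i f g).IsGuess ↔ c.IsGuess := by
  cases c <;> rfl

end Instr

/-- The data a program fragment acts on. -/
@[ext]
structure Mem (ι K : Type) where
  /-- stack contents, top first -/
  stk : K → List Bool
  /-- outcomes of future choices -/
  coins : ℕ → Bool
  /-- oracles queried so far -/
  asked : List ι

/-- The memory with `x` on stack `k` and all other stacks empty. -/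
def Mem.init {ι K : Type} [DecidableEq K] (k : K) (coins : ℕ → Bool) (x : List Bool) : Mem ι K where
  stk := update (fun _ => []) k x
  coins := coins
  asked := []

open scoped Classical in
/-- The effect of one instruction: the next state and the new memory. -/
noncomputable def Instr.next {ι K Q : Type} [DecidableEq K] (O : ι → Language Bool) (m : Mem ι K) :
    Instr ι K Q → Option (Q × Mem ι K)
  | .push k b q => some (q, { m with stk := update m.stk k (b :: m.stk k) })
  | .pop k n => some (n (m.stk k).head?, { m with stk := update m.stk k (m.stk k).tail })
  | .guess n => some (n (m.coins 0), { m with coins := fun j => m.coins (j + 1) })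
  | .query i k n => some (n (decide (m.stk k ∈ O i)), { m with asked := m.asked ++ [i] })
  | .halt _ => none

theorem Instr.next_map_id {ι K Q Q' : Type} [DecidableEq K] (O : ι → Language Bool) (m : Mem ι K)
    (c : Instr ι K Q) (g : Q → Q') :
    (c.map id id g).next O m = (c.next O m).map (Prod.map g id) := by
  cases c <;> rfl

theorem update_extend {K K' α : Type*} [DecidableEq K] [DecidableEq K'] {f : K → K'}
    (hf : Injective f) (s : K → α) (s₀ : K' → α) (k : K) (v : α) :
    update (extend f s s₀) (f k) v = extend f (update s k v) s₀ := by
  funext k'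
  by_cases h : ∃ a, f a = k'
  · obtain ⟨a, rfl⟩ := h
    simp [update_apply, hf.extend_apply, hf.eq_iff]
  · rw [update_of_ne (fun h' => h ⟨k, h'.symm⟩), extend_apply' _ _ _ h, extend_apply' _ _ _ h]

theorem Instr.next_map {ι ι' K K' Q : Type} [DecidableEq K] [DecidableEq K'] {O : ι' → Language Bool}
    {i : ι → ι'} {f : K → K'} (hf : Injective f) (m : Mem ι K) (c : Instr ι K Q)
    (s : K' → List Bool) (a : List ι') (g : Mem ι K → Mem ι' K')
    (hg : g = fun m => ⟨extend f m.stk s, m.coins, a ++ m.asked.map i⟩) :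
    (c.map i f id).next O (g m) = (c.next (O ∘ i) m).map (Prod.map id g) := by
  subst hg
  cases c <;> simp [Instr.map, Instr.next, update_extend hf, hf.extend_apply]
  exact congrArg _ (decide_eq_decide.2 (by rw [hf.extend_apply]))

/-- A program fragment: a flow chart that is left through one of the exits `E`. -/
structure Block (ι K E : Type) : Type 1 where
  /-- control states -/
  Q : Type
  [finQ : Fintype Q]
  /-- where to begin -/
  start : Q ⊕ E
  /-- the program -/
  instr : Q → Instr ι K (Q ⊕ E)

attribute [instance] Block.finQ

namespace Block

variable {ι ι' K K' E E' : Type}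

/-- The fragment makes no nondeterministic choice. -/
def Det (B : Block ι K E) : Prop := ∀ q, ¬ (B.instr q).IsGuess

section semantics

variable [DecidableEq K] [DecidableEq K'] {O : ι → Language Bool}

/-- `B.Path O r m t e m'`: started at `r` with memory `m`, the fragment is left after `t` steps
through exit `e` with memory `m'`. -/
inductive Path (O : ι → Language Bool) (B : Block ι K E) :
    B.Q ⊕ E → Mem ι K → ℕ → E → Mem ι K → Prop
  | done (e : E) (m : Mem ι K) : Path O B (.inr e) m 0 e m
  | step {q : B.Q} {r : B.Q ⊕ E} {m m₁ m₂ : Mem ι K} {t : ℕ} {e : E} :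
      (B.instr q).next O m = some (r, m₁) → Path O B r m₁ t e m₂ →
        Path O B (.inl q) m (t + 1) e m₂

/-- Started with memory `m`, the fragment is left after at most `T` steps through exit `e` with
memory `m'`. -/
def Runs (O : ι → Language Bool) (B : Block ι K E) (m : Mem ι K) (T : ℕ) (e : E) (m' : Mem ι K) :
    Prop :=
  ∃ t ≤ T, B.Path O B.start m t e m'

/-- The coins are part of the memory, so even a guessing fragment evolves as a function of where it
starts. -/
theorem Path.unique {B : Block ι K E} {r : B.Q ⊕ E} {m m₁ m₂ : Mem ι K} {t₁ t₂ : ℕ} {e₁ e₂ : E}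
    (h₁ : B.Path O r m t₁ e₁ m₁) (h₂ : B.Path O r m t₂ e₂ m₂) : e₁ = e₂ ∧ m₁ = m₂ := by
  induction h₁ generalizing t₂ with
  | done => cases h₂; exact ⟨rfl, rfl⟩
  | step hn _ ih =>
    cases h₂ with
    | step hn' h' =>
      rw [hn] at hn'
      simp only [Option.some.injEq, Prod.mk.injEq] at hn'
      obtain ⟨rfl, rfl⟩ := hn'
      exact ih h'

theorem Runs.unique {B : Block ι K E} {m m₁ m₂ : Mem ι K} {T₁ T₂ : ℕ} {e₁ e₂ : E}
    (h₁ : B.Runs O m T₁ e₁ m₁) (h₂ : B.Runs O m T₂ e₂ m₂) : e₁ = e₂ ∧ m₁ = m₂ := by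
  obtain ⟨_, _, h₁⟩ := h₁
  obtain ⟨_, _, h₂⟩ := h₂
  exact h₁.unique h₂

theorem Runs.mono {B : Block ι K E} {m m' : Mem ι K} {T T' : ℕ} {e : E}
    (h : B.Runs O m T e m') (hT : T ≤ T') : B.Runs O m T' e m' := by
  obtain ⟨t, ht, h⟩ := h
  exact ⟨t, ht.trans hT, h⟩

theorem Runs.of_eq {B : Block ι K E} {m m' m'' : Mem ι K} {T T' : ℕ} {e : E}
    (h : B.Runs O m T e m') (hT : T ≤ T') (hs : ∀ k, m'.stk k = m''.stk k)
    (hc : m'.coins = m''.coins) (ha : m'.asked = m''.asked) : B.Runs O m T' e m'' := by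
  obtain rfl : m' = m'' := Mem.ext (funext hs) hc ha
  exact h.mono hT

/-- An instruction pushes at most one bit. This is what keeps the input of a subsequent machine
polynomially long. -/
theorem Path.length_le {B : Block ι K E} {r : B.Q ⊕ E} {m m' : Mem ι K} {t : ℕ} {e : E}
    (h : B.Path O r m t e m') (k : K) : (m'.stk k).length ≤ (m.stk k).length + t := by
  induction h with
  | done => simp
  | @step q r m m₁ m₂ t e hn _ ih =>
    have : (m₁.stk k).length ≤ (m.stk k).length + 1 := by
      cases hi : B.instr q <;> rw [hi] at hn <;> simp only [Instr.next, Option.some.injEq,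
        Prod.mk.injEq, reduceCtorEq] at hn <;> obtain ⟨_, rfl⟩ := hn
      · simp only [update_apply]
        split_ifs with hk
        · simp [hk]
        · omega
      · simp only [update_apply]
        split_ifs with hk
        · simp only [hk, List.length_tail]; omega
        · omega
      · simp
      · simp
    omega

theorem Runs.length_le {B : Block ι K E} {m m' : Mem ι K} {T : ℕ} {e : E}
    (h : B.Runs O m T e m') (k : K) : (m'.stk k).length ≤ (m.stk k).length + T := by
  obtain ⟨t, ht, h⟩ := h
  have := h.length_le k
  omega

/-- The coins not consumed by a run can be exchanged for others. -/
theorem Path.recoin {B : Block ι K E} {r : B.Q ⊕ E} {m m' : Mem ι K} {t : ℕ} {e : E}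
    (h : B.Path O r m t e m') (d : ℕ → Bool) :
    ∃ c, B.Path O r { m with coins := c } t e { m' with coins := d } := by
  induction h with
  | done e m => exact ⟨d, .done _ _⟩
  | @step q r m m₁ m₂ t e hn _ ih =>
    obtain ⟨c, hc⟩ := ih
    cases hi : B.instr q with
    | guess n =>
      rw [hi] at hn
      simp only [Instr.next, Option.some.injEq, Prod.mk.injEq] at hn
      obtain ⟨rfl, rfl⟩ := hn
      -- The coin just consumed is put back in front of the coins found for the rest of the path.
      refine ⟨fun j => Nat.casesOn j (m.coins 0) c, .step (r := n (m.coins 0)) ?_ hc⟩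
      rw [hi]
      rfl
    | _ =>
      rw [hi] at hn
      simp only [Instr.next, Option.some.injEq, Prod.mk.injEq, reduceCtorEq] at hn
      all_goals
        obtain ⟨rfl, rfl⟩ := hn
        refine ⟨c, .step ?_ hc⟩
        rw [hi]
        rfl

theorem Runs.recoin {B : Block ι K E} {m m' : Mem ι K} {T : ℕ} {e : E}
    (h : B.Runs O m T e m') (d : ℕ → Bool) :
    ∃ c, B.Runs O { m with coins := c } T e { m' with coins := d } := by
  obtain ⟨t, ht, h⟩ := h
  obtain ⟨c, hc⟩ := h.recoin d
  exact ⟨c, t, ht, hc⟩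

end semantics

/-! ### Renaming -/

/-- Rename oracles and stacks. -/
def map (i : ι → ι') (f : K → K') (B : Block ι K E) : Block ι' K' E where
  Q := B.Q
  start := B.start
  instr q := (B.instr q).map i f id

theorem Det.map {B : Block ι K E} (h : B.Det) (i : ι → ι') (f : K → K') : (B.map i f).Det :=
  fun q => by
    have := h q
    rwa [← Instr.isGuess_map i f id] at this

theorem Path.map [DecidableEq K] [DecidableEq K'] {O : ι' → Language Bool} {B : Block ι K E}
    {i : ι → ι'} {f : K → K'} (hf : Injective f) {r : B.Q ⊕ E} {m m' : Mem ι K} {t : ℕ} {e : E}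
    (h : B.Path (O ∘ i) r m t e m') (s : K' → List Bool) (a : List ι') :
    (B.map i f).Path O r ⟨extend f m.stk s, m.coins, a ++ m.asked.map i⟩ t e
      ⟨extend f m'.stk s, m'.coins, a ++ m'.asked.map i⟩ := by
  induction h with
  | done => exact .done _ _
  | @step q r m m₁ m₂ t e hn _ ih =>
    refine .step (B := B.map i f) (r := r) ?_ ih
    have key := Instr.next_map (O := O) (i := i) hf m (B.instr q) s a _ rfl
    rw [hn] at key
    exact key

theorem Runs.map [DecidableEq K] [DecidableEq K'] {O : ι' → Language Bool} {B : Block ι K E}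
    {i : ι → ι'} {f : K → K'} (hf : Injective f) {m m' : Mem ι K} {T : ℕ} {e : E}
    (h : B.Runs (O ∘ i) m T e m') (w : Mem ι' K') (a : List ι') (hs : ∀ k, w.stk (f k) = m.stk k)
    (hc : w.coins = m.coins) (ha : w.asked = a ++ m.asked.map i) :
    (B.map i f).Runs O w T e ⟨extend f m'.stk w.stk, m'.coins, a ++ m'.asked.map i⟩ := by
  obtain ⟨t, ht, h⟩ := h
  have : w = ⟨extend f m.stk w.stk, m.coins, a ++ m.asked.map i⟩ := by
    ext1
    · funext k'
      by_cases h : ∃ a, f a = k'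
      · obtain ⟨a, rfl⟩ := h
        simp [hf.extend_apply, hs]
      · exact (extend_apply' _ _ _ h).symm
    · exact hc
    · exact ha
  refine ⟨t, ht, ?_⟩
  have key := h.map hf w.stk a
  rwa [← this] at key

/-! ### Basic fragments -/

/-- Leave immediately. -/
def ret (e : E) : Block ι K E where
  Q := Empty
  start := .inr e
  instr := Empty.elim

/-- Push a bit. -/
def push (k : K) (b : Bool) : Block ι K Unit where
  Q := Unit
  start := .inl ()
  instr _ := .push k b (.inr ())

/-- Remove the top bit and return it. -/
def pop (k : K) : Block ι K (Option Bool) where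
  Q := Unit
  start := .inl ()
  instr _ := .pop k .inr

/-- A nondeterministic bit. -/
def guess : Block ι K Bool where
  Q := Unit
  start := .inl ()
  instr _ := .guess .inr

/-- Return the answer of oracle `i` about the string on stack `k`. -/
def query (i : ι) (k : K) : Block ι K Bool where
  Q := Unit
  start := .inl ()
  instr _ := .query i k .inr

/-- Where a jump within the first part of a composition leads to. -/
def bindDest (B : Block ι K E) (C : E → Block ι K E') :
    B.Q ⊕ E → (B.Q ⊕ Σ e, (C e).Q) ⊕ E'
  | .inl q => .inl (.inl q)
  | .inr e => Sum.map (fun q => .inr ⟨e, q⟩) id (C e).start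

/-- Sequential composition. -/
def bind [Fintype E] (B : Block ι K E) (C : E → Block ι K E') : Block ι K E' where
  Q := B.Q ⊕ Σ e, (C e).Q
  start := B.bindDest C B.start
  instr
    | .inl q => (B.instr q).map id id (B.bindDest C)
    | .inr ⟨e, q⟩ => ((C e).instr q).map id id (Sum.map (fun q => .inr ⟨e, q⟩) id)

/-- Where a jump within the body of a loop leads to. -/
def loopDest (C : Option Bool → Block ι K (Option E)) (o : Option Bool) :
    (C o).Q ⊕ Option E → (Unit ⊕ Σ o, (C o).Q) ⊕ E
  | .inl q => .inl (.inr ⟨o, q⟩)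
  | .inr none => .inl (.inl ())
  | .inr (some e) => .inr e

/-- Pop a bit from stack `k` and run the body for it, until the body returns a value. -/
def loop (k : K) (C : Option Bool → Block ι K (Option E)) : Block ι K E where
  Q := Unit ⊕ Σ o, (C o).Q
  start := .inl (.inl ())
  instr
    | .inl _ => .pop k fun o => loopDest C o (C o).start
    | .inr ⟨o, q⟩ => ((C o).instr q).map id id (loopDest C o)

theorem det_ret (e : E) : (ret e : Block ι K E).Det := fun q => q.elim
theorem det_push (k : K) (b : Bool) : (push k b : Block ι K Unit).Det := fun _ h => h
theorem det_pop (k : K) : (pop k : Block ι K (Option Bool)).Det := fun _ h => h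
theorem det_query (i : ι) (k : K) : (query i k).Det := fun _ h => h

theorem Det.bind [Fintype E] {B : Block ι K E} {C : E → Block ι K E'} (hB : B.Det)
    (hC : ∀ e, (C e).Det) : (B.bind C).Det := by
  rintro (q | ⟨e, q⟩) h
  · exact hB q ((Instr.isGuess_map _ _ _ _).1 h)
  · exact hC e q ((Instr.isGuess_map _ _ _ _).1 h)

theorem Det.loop {k : K} {C : Option Bool → Block ι K (Option E)} (hC : ∀ o, (C o).Det) :
    (loop k C).Det := by
  rintro (q | ⟨e, q⟩) h
  · exact h
  · exact hC e q ((Instr.isGuess_map _ _ _ _).1 h)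

section semantics

variable [DecidableEq K] {O : ι → Language Bool}

theorem runs_ret (e : E) (m : Mem ι K) (T : ℕ) : (ret e).Runs O m T e m :=
  ⟨0, Nat.zero_le _, .done _ _⟩

theorem runs_push (k : K) (b : Bool) (m : Mem ι K) :
    (push k b).Runs O m 1 () { m with stk := update m.stk k (b :: m.stk k) } :=
  ⟨1, le_rfl, .step rfl (.done _ _)⟩

theorem runs_pop (k : K) (m : Mem ι K) :
    (pop k).Runs O m 1 (m.stk k).head? { m with stk := update m.stk k (m.stk k).tail } :=
  ⟨1, le_rfl, .step rfl (.done _ _)⟩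

theorem runs_guess (m : Mem ι K) :
    guess.Runs O m 1 (m.coins 0) { m with coins := fun j => m.coins (j + 1) } :=
  ⟨1, le_rfl, .step rfl (.done _ _)⟩

open scoped Classical in
theorem runs_query (i : ι) (k : K) (m : Mem ι K) :
    (query i k).Runs O m 1 (decide (m.stk k ∈ O i)) { m with asked := m.asked ++ [i] } :=
  ⟨1, le_rfl, .step rfl (.done _ _)⟩

theorem Path.bind_right [Fintype E] {B : Block ι K E} {C : E → Block ι K E'} {e : E}
    {r : (C e).Q ⊕ E'} {m m' : Mem ι K} {t : ℕ} {e' : E'} (h : (C e).Path O r m t e' m') :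
    (B.bind C).Path O (Sum.map (fun q => Sum.inr ⟨e, q⟩) id r) m t e' m' := by
  induction h with
  | done => exact .done _ _
  | @step q r m m₁ m₂ t e' hn _ ih =>
    refine .step (B := B.bind C) (q := Sum.inr ⟨e, q⟩) ?_ ih
    exact (Instr.next_map_id _ _ _ _).trans (by rw [hn]; rfl)

theorem Path.bind_left [Fintype E] {B : Block ι K E} {C : E → Block ι K E'} {r : B.Q ⊕ E}
    {m m₁ m₂ : Mem ι K} {t t' : ℕ} {e : E} {e' : E'} (h : B.Path O r m t e m₁)
    (h' : (C e).Path O (C e).start m₁ t' e' m₂) :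
    (B.bind C).Path O (B.bindDest C r) m (t + t') e' m₂ := by
  induction h with
  | done => rw [Nat.zero_add]; exact h'.bind_right
  | @step q r m m₁ m₂ t e hn _ ih =>
    rw [Nat.add_right_comm]
    refine .step (B := B.bind C) (q := Sum.inl q) ?_ (ih h')
    exact (Instr.next_map_id _ _ _ _).trans (by rw [hn]; rfl)

theorem Runs.bind [Fintype E] {B : Block ι K E} {C : E → Block ι K E'} {m m₁ m₂ : Mem ι K}
    {T₁ T₂ : ℕ} {e : E} {e' : E'} (h₁ : B.Runs O m T₁ e m₁) (h₂ : (C e).Runs O m₁ T₂ e' m₂) :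
    (B.bind C).Runs O m (T₁ + T₂) e' m₂ := by
  obtain ⟨t₁, ht₁, h₁⟩ := h₁
  obtain ⟨t₂, ht₂, h₂⟩ := h₂
  exact ⟨t₁ + t₂, by omega, h₁.bind_left h₂⟩

theorem Path.loop_body {k : K} {C : Option Bool → Block ι K (Option E)} {o : Option Bool} {r}
    {m m₁ : Mem ι K} {t : ℕ} {e : Option E} (h : (C o).Path O r m t e m₁) {t' : ℕ} {e' : E}
    {m₂ : Mem ι K} (h' : (loop k C).Path O (loopDest C o (.inr e)) m₁ t' e' m₂) :
    (loop k C).Path O (loopDest C o r) m (t + t') e' m₂ := by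
  induction h with
  | done => rw [Nat.zero_add]; exact h'
  | @step q r m m₁ m₂ t e hn _ ih =>
    rw [Nat.add_right_comm]
    refine .step (B := loop k C) (q := Sum.inr ⟨o, q⟩) ?_ (ih h')
    exact (Instr.next_map_id _ _ _ _).trans (by rw [hn]; rfl)

theorem Runs.loop_exit {k : K} {C : Option Bool → Block ι K (Option E)} {m m₁ : Mem ι K} {T : ℕ}
    {e : E} (h : (C (m.stk k).head?).Runs O { m with stk := update m.stk k (m.stk k).tail } T
      (some e) m₁) :
    (loop k C).Runs O m (T + 1) e m₁ := by
  obtain ⟨t, ht, h⟩ := h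
  refine ⟨t + 1, by omega, .step rfl ?_⟩
  exact h.loop_body (.done _ _)

theorem Runs.loop_next {k : K} {C : Option Bool → Block ι K (Option E)} {m m₁ m₂ : Mem ι K}
    {T T' : ℕ} {e : E} (h : (C (m.stk k).head?).Runs O
      { m with stk := update m.stk k (m.stk k).tail } T none m₁)
    (h' : (loop k C).Runs O m₁ T' e m₂) :
    (loop k C).Runs O m (T + T' + 1) e m₂ := by
  obtain ⟨t, ht, h⟩ := h
  obtain ⟨t', ht', h'⟩ := h'
  exact ⟨t + t' + 1, by omega, .step rfl (h.loop_body h')⟩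

end semantics

end Block

/-! ### Machines from fragments and fragments from machines -/

section toMachine

variable {ι K : Type} [Fintype K] [DecidableEq K]

/-- The machine that runs a fragment and halts with the verdict it returns. -/
def Block.toMachine (B : Block ι K Bool) (inp out : K) : Machine ι where
  Q := B.Q ⊕ Bool
  K := K
  start := B.start
  inp := inp
  out := out
  instr
    | .inl q => B.instr q
    | .inr b => .halt b

theorem Block.Det.toMachine {B : Block ι K Bool} (h : B.Det) (inp out : K) :
    (B.toMachine inp out).Deterministic := by
  rintro (q | b) n hn
  · exact h q (by
      have hn' : B.instr q = .guess n := hn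
      rw [hn']
      trivial)
  · cases hn

theorem Block.Path.iterate {O : ι → Language Bool} {B : Block ι K Bool} {inp out : K}
    {r : B.Q ⊕ Bool} {m m' : Mem ι K} {t : ℕ} {b : Bool} (h : B.Path O r m t b m') :
    ((B.toMachine inp out).step O)^[t]
      (⟨r, m.stk, m.coins, m.asked⟩ : (B.toMachine inp out).Cfg) =
      ⟨Sum.inr b, m'.stk, m'.coins, m'.asked⟩ := by
  induction h with
  | done => rfl
  | @step q r m m₁ m₂ t e hn _ ih =>
    rw [iterate_succ_apply, ← ih]
    congr 1
    have hi : (B.toMachine inp out).instr (Sum.inl q) = B.instr q := rfl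
    unfold Machine.step
    simp only [hi]
    cases hq : B.instr q <;> rw [hq] at hn <;> simp only [Instr.next, Option.some.injEq,
        Prod.mk.injEq, reduceCtorEq] at hn <;> obtain ⟨rfl, rfl⟩ := hn <;> rfl

theorem Block.Runs.run {O : ι → Language Bool} {B : Block ι K Bool} {inp out : K} {x : List Bool}
    {coins : ℕ → Bool} {m' : Mem ι K} {T : ℕ} {b : Bool}
    (h : B.Runs O (Mem.init inp coins x) T b m') :
    ∃ t ≤ T, (B.toMachine inp out).run O coins x t =
      ⟨Sum.inr b, m'.stk, m'.coins, m'.asked⟩ := by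
  obtain ⟨t, ht, h⟩ := h
  exact ⟨t, ht, h.iterate⟩

end toMachine

namespace Machine

variable {ι : Type} {M : Machine ι} {O : ι → Language Bool}

theorem step_of_halt {c : M.Cfg} {b : Bool} (h : M.instr c.state = .halt b) : M.step O c = c := by
  unfold step
  rw [h]

theorem run_succ (O : ι → Language Bool) (coins : ℕ → Bool) (x : List Bool) (t : ℕ) :
    M.run O coins x (t + 1) = M.step O (M.run O coins x t) :=
  iterate_succ_apply' _ _ _

theorem run_of_halt {coins : ℕ → Bool} {x : List Bool} {t t' : ℕ} {b : Bool}
    (h : M.instr (M.run O coins x t).state = .halt b) (ht : t ≤ t') :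
    M.run O coins x t' = M.run O coins x t := by
  induction ht with
  | refl => rfl
  | step _ ih => rw [run_succ, ih, step_of_halt h]

theorem run_eq_of_halt {coins : ℕ → Bool} {x : List Bool} {t t' : ℕ} {b b' : Bool}
    (h : M.instr (M.run O coins x t).state = .halt b)
    (h' : M.instr (M.run O coins x t').state = .halt b') :
    M.run O coins x t = M.run O coins x t' ∧ b = b' := by
  have key : M.run O coins x t = M.run O coins x t' := by
    rcases le_total t t' with ht | ht
    · exact (run_of_halt h ht).symm
    · exact run_of_halt h' ht
  rw [key, h'] at h
  cases h
  exact ⟨key, rfl⟩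

/-- Where a jump to state `q` leads when queries are answered by `ans`: halting states and queries
without a prescribed answer are exits. -/
def simDest (M : Machine ι) (ans : ι → Option Bool) (q : M.Q) : M.Q ⊕ (Bool ⊕ M.K) :=
  match M.instr q with
  | .halt b => .inr (.inl b)
  | .query i k _ => if ans i = none then .inr (.inr k) else .inl q
  | _ => .inl q

/-- Run a machine with oracle `i` giving the answer `ans i`.  If the machine halts, return its
verdict; if it asks an oracle without a prescribed answer, return the stack it asks about.  The
stack `none` is auxiliary. -/
def sim {ι' : Type} (M : Machine ι) (ans : ι → Option Bool) :
    Block ι' (Option M.K) (Bool ⊕ M.K) where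
  Q := M.Q
  start := M.simDest ans M.start
  instr q := match M.instr q with
    | .push k b n => .push (some k) b (M.simDest ans n)
    | .pop k n => .pop (some k) fun o => M.simDest ans (n o)
    | .guess n => .guess fun b => M.simDest ans (n b)
    | .query i _ n => .push none false (M.simDest ans (n ((ans i).getD false)))
    | .halt b => .halt b

theorem Deterministic.sim (h : M.Deterministic) {ι' : Type} (ans : ι → Option Bool) :
    (M.sim ans : Block ι' _ _).Det := by
  intro q hq
  change (match M.instr q with
    | .push k b n => .push (some k) b (M.simDest ans n)
    | .pop k n => .pop (some k) fun o => M.simDest ans (n o)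
    | .guess n => .guess fun b => M.simDest ans (n b)
    | .query i _ n => .push none false (M.simDest ans (n ((ans i).getD false)))
    | .halt b => .halt b : Instr ι' (Option M.K) (M.Q ⊕ (Bool ⊕ M.K))).IsGuess at hq
  cases hi : M.instr q with
  | guess n => exact h q n hi
  | _ => rw [hi] at hq; exact hq

/-- The memory of the simulation of a configuration; `d` is the content of the auxiliary stack. -/
def Cfg.mem {ι' : Type} (c : M.Cfg) (d : List Bool) (a : List ι') : Mem ι' (Option M.K) :=
  ⟨fun o => o.elim d c.stk, c.coins, a⟩

theorem elim_update {K α : Type*} [DecidableEq K] (s : K → α) (d : α) (k : K) (v : α) :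
    update (fun o : Option K => o.elim d s) (some k) v = fun o => o.elim d (update s k v) := by
  funext o
  cases o <;> simp [update_apply]

theorem elim_update_none {K α : Type*} [DecidableEq K] (s : K → α) (d v : α) :
    update (fun o : Option K => o.elim d s) none v = fun o => o.elim v s := by
  funext o
  cases o <;> simp

theorem init_mem {ι' : Type} (coins : ℕ → Bool) (x : List Bool) :
    (M.init coins x).mem [] [] = (Mem.init (some M.inp) coins x : Mem ι' _) := by
  ext1 <;> try rfl
  funext o
  cases o <;> simp [Cfg.mem, Mem.init, init, update_apply]

/-- The simulation faithfully follows the machine until it halts or asks for an answer that is not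
prescribed. -/
theorem sim_path {ι' : Type} {O' : ι' → Language Bool} {ans : ι → Option Bool}
    (hO : ∀ i b, ans i = some b → ∀ y, y ∈ O i ↔ b = true) (a : List ι') (t : ℕ) :
    ∀ (c : M.Cfg) (d : List Bool) (b : Bool), M.instr ((M.step O)^[t] c).state = .halt b →
      (∃ t' ≤ t, ∃ d', (M.sim ans).Path O' (M.simDest ans c.state) (c.mem d a) t' (.inl b)
          (((M.step O)^[t] c).mem d' a) ∧
        ∀ s i k n, M.instr ((M.step O)^[s] c).state = .query i k n → ans i ≠ none) ∨
      ∃ t' ≤ t, ∃ d' i k n, (M.sim ans).Path O' (M.simDest ans c.state) (c.mem d a) t' (.inr k)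
          (((M.step O)^[t'] c).mem d' a) ∧
        M.instr ((M.step O)^[t'] c).state = .query i k n ∧ ans i = none ∧
        ∀ s < t', ∀ i k n, M.instr ((M.step O)^[s] c).state = .query i k n → ans i ≠ none := by
  have hhalt : ∀ (c : M.Cfg) (t : ℕ) (b : Bool), M.instr c.state = .halt b →
      (M.step O)^[t] c = c := fun c t b h => iterate_fixed (step_of_halt h) t
  have now : ∀ (t : ℕ) (c : M.Cfg) (d : List Bool) (b : Bool), M.instr c.state = .halt b →
      (∃ t' ≤ t, ∃ d', (M.sim ans).Path O' (M.simDest ans c.state) (c.mem d a) t' (.inl b)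
          (((M.step O)^[t] c).mem d' a) ∧
        ∀ s i k n, M.instr ((M.step O)^[s] c).state = .query i k n → ans i ≠ none) := by
    intro t c d b h
    have hd : M.simDest ans c.state = .inr (.inl b) := by simp [simDest, h]
    refine ⟨0, Nat.zero_le _, d, ?_, fun s i k n hs => ?_⟩
    · rw [hd, hhalt c t b h]
      exact .done _ _
    · rw [hhalt c s b h, h] at hs
      cases hs
  induction t with
  | zero => exact fun c d b h => .inl (now 0 c d b h)
  | succ t ih =>
    intro c d b h
    rw [iterate_succ_apply] at h
    -- Common treatment of every instruction that the simulation carries out: one step on both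
    -- sides, then the induction hypothesis for `M.step O c`.
    have main : ∀ d₁, M.simDest ans c.state = .inl c.state →
        ((M.sim ans : Block ι' _ _).instr c.state).next O' (c.mem d a) =
          some (M.simDest ans (M.step O c).state, (M.step O c).mem d₁ a) →
        (∀ i k n, M.instr c.state = .query i k n → ans i ≠ none) →
        (∃ t' ≤ t + 1, ∃ d', (M.sim ans).Path O' (M.simDest ans c.state) (c.mem d a) t' (.inl b)
            (((M.step O)^[t + 1] c).mem d' a) ∧
          ∀ s i k n, M.instr ((M.step O)^[s] c).state = .query i k n → ans i ≠ none) ∨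
        ∃ t' ≤ t + 1, ∃ d' i k n, (M.sim ans).Path O' (M.simDest ans c.state) (c.mem d a) t'
            (.inr k) (((M.step O)^[t'] c).mem d' a) ∧
          M.instr ((M.step O)^[t'] c).state = .query i k n ∧ ans i = none ∧
          ∀ s < t', ∀ i k n, M.instr ((M.step O)^[s] c).state = .query i k n →
            ans i ≠ none := by
      intro d₁ hd hn hq
      rw [hd]
      rcases ih (M.step O c) d₁ b h with ⟨t', ht', d', hp, hs⟩ | ⟨t', ht', d', i, k, n, hp, hi, hn', hs⟩
      · refine .inl ⟨t' + 1, by omega, d', .step hn hp, fun s => ?_⟩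
        cases s with
        | zero => exact hq
        | succ s => exact hs s
      · refine .inr ⟨t' + 1, by omega, d', i, k, n, .step hn hp, hi, hn', fun s hlt => ?_⟩
        cases s with
        | zero => exact hq
        | succ s => exact hs s (by omega)
    have hsim : (M.sim ans : Block ι' _ _).instr c.state = match M.instr c.state with
        | .push k b n => .push (some k) b (M.simDest ans n)
        | .pop k n => .pop (some k) fun o => M.simDest ans (n o)
        | .guess n => .guess fun b => M.simDest ans (n b)
        | .query i _ n => .push none false (M.simDest ans (n ((ans i).getD false)))
        | .halt b => .halt b := rfl
    cases hi : M.instr c.state with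
    | halt b' =>
      rw [step_of_halt hi] at h
      exact .inl (now (t + 1) c d b (by rwa [hhalt c t b' hi] at h))
    | push k b' n =>
      refine main d (by simp [simDest, hi]) ?_ (by simp [hi])
      rw [hsim]
      simp [hi, Instr.next, step, Cfg.mem, elim_update]
      rfl
    | pop k n =>
      refine main d (by simp [simDest, hi]) ?_ (by simp [hi])
      rw [hsim]
      simp [hi, Instr.next, step, Cfg.mem, elim_update]
      rfl
    | guess n =>
      refine main d (by simp [simDest, hi]) ?_ (by simp [hi])
      rw [hsim]
      simp [hi, Instr.next, step, Cfg.mem]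
      rfl
    | query i k n =>
      rcases ha : ans i with _ | b'
      · refine .inr ⟨0, Nat.zero_le _, d, i, k, n, ?_, hi, ha, by simp⟩
        have hd : M.simDest ans c.state = .inr (.inr k) := by simp [simDest, hi, ha]
        rw [hd]
        exact .done _ _
      · have hb : ∀ y (_ : Decidable (y ∈ O i)), decide (y ∈ O i) = b' := by
          intro y _
          have := hO i b' ha y
          cases b' <;> simp [this]
        -- A query with a prescribed answer is replaced by a dummy push on the auxiliary stack, so
        -- machine and simulation stay in lockstep and the time bound carries over.
        refine main (false :: d) (by simp [simDest, hi, ha]) ?_ (by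
          intro i' k' n' h'
          cases hi.symm.trans h'
          simp [ha])
        rw [hsim]
        simp [hi, Instr.next, step, Cfg.mem, elim_update_none, ha, hb]
        rfl

theorem sim_run {ι' : Type} {O' : ι' → Language Bool} {ans : ι → Option Bool}
    (hO : ∀ i b, ans i = some b → ∀ y, y ∈ O i ↔ b = true) {coins : ℕ → Bool} {x : List Bool}
    {t : ℕ} {b : Bool} (h : M.instr (M.run O coins x t).state = .halt b) :
    (∃ d, (M.sim ans).Runs O' (Mem.init (some M.inp) coins x) t (.inl b)
        ((M.run O coins x t).mem d []) ∧
      ∀ s i k n, M.instr (M.run O coins x s).state = .query i k n → ans i ≠ none) ∨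
    ∃ t' d i k n, (M.sim ans).Runs O' (Mem.init (some M.inp) coins x) t (.inr k)
        ((M.run O coins x t').mem d []) ∧
      M.instr (M.run O coins x t').state = .query i k n ∧ ans i = none ∧
      ∀ s < t', ∀ i k n, M.instr (M.run O coins x s).state = .query i k n → ans i ≠ none := by
  rw [← init_mem coins x]
  rcases sim_path (O' := O') hO [] t (M.init coins x) [] b h with
    ⟨t', ht', d, hp, hs⟩ | ⟨t', ht', d, i, k, n, hp, hi⟩
  · exact .inl ⟨d, ⟨t', ht', hp⟩, hs⟩
  · exact .inr ⟨t', d, i, k, n, ⟨t', ht', hp⟩, hi⟩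

end Machine

/-! ### Predicates in NP and in P -/

/-- Membership in NP, for predicates. -/
def IsNP (P : List Bool → Prop) : Prop :=
  ∃ M : Machine Empty, M.PolyTime ∧ ∀ x, P x ↔ M.Accepts Empty.elim x

/-- Deterministic polynomial time, for predicates. -/
def IsP (P : List Bool → Prop) : Prop :=
  ∃ (K : Type) (_ : Fintype K) (_ : DecidableEq K) (B : Block Empty K Bool) (inp : K)
    (p : Polynomial ℕ), B.Det ∧ ∀ coins x, ∃ b m',
      B.Runs Empty.elim (Mem.init inp coins x) (p.eval x.length) b m' ∧ (P x ↔ b = true)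

theorem IsNP.congr {P P' : List Bool → Prop} (h : IsNP P) (hP : ∀ x, P' x ↔ P x) : IsNP P' := by
  obtain ⟨M, hM, hx⟩ := h
  exact ⟨M, hM, fun x => (hP x).trans (hx x)⟩

theorem IsP.congr {P P' : List Bool → Prop} (h : IsP P) (hP : ∀ x, P' x ↔ P x) : IsP P' := by
  obtain rfl : P' = P := funext fun x => propext (hP x)
  exact h

theorem eval_mono (p : Polynomial ℕ) : Monotone fun n => p.eval n := by
  intro a b hab
  simp only [Polynomial.eval_eq_sum_range]
  exact Finset.sum_le_sum fun i _ => Nat.mul_le_mul_left _ (Nat.pow_le_pow_left hab i)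

theorem Mem.length_init_le {ι K : Type} [DecidableEq K] (inp k : K) (coins : ℕ → Bool)
    (x : List Bool) : ((Mem.init inp coins x : Mem ι K).stk k).length ≤ x.length := by
  simp only [Mem.init, update_apply]
  split_ifs <;> simp

/-- The fragment that runs a machine without oracles and returns its verdict. -/
def Machine.toBlock (M : Machine Empty) {ι' : Type} : Block ι' (Option M.K) Bool :=
  (M.sim fun _ => none).bind fun r => .ret (r.elim id fun _ => false)

theorem Machine.Deterministic.toBlock {M : Machine Empty} (h : M.Deterministic) {ι' : Type} :
    (M.toBlock : Block ι' _ _).Det :=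
  (h.sim _).bind fun _ => Block.det_ret _

theorem Machine.toBlock_runs {M : Machine Empty} {ι' : Type} {O' : ι' → Language Bool}
    {O : Empty → Language Bool} {coins : ℕ → Bool} {x : List Bool} {t : ℕ} {b : Bool}
    (h : M.instr (M.run O coins x t).state = .halt b) :
    ∃ d, M.toBlock.Runs O' (Mem.init (some M.inp) coins x) t b ((M.run O coins x t).mem d []) := by
  rcases M.sim_run (O' := O') (ans := fun _ => none) (fun i => i.elim) h with
    ⟨d, hp, _⟩ | ⟨_, _, i, _⟩
  · exact ⟨d, Block.Runs.bind (C := fun r : Bool ⊕ M.K => .ret (r.elim id fun _ => false)) hp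
      (Block.runs_ret b _ 0)⟩
  · exact i.elim

/-! ### NP predicates from a fragment followed by an NP check -/

section ofBlock

variable {K E : Type}

/-- Use stack `k` as the input stack of a machine, with fresh stacks in place of the others. -/
def attach [DecidableEq E] (M : E → Machine Empty) (κ : E → K) (e : E) (o : Option (M e).K) :
    K ⊕ Σ e, Option (M e).K :=
  if o = some (M e).inp then .inl (κ e) else .inr ⟨e, o⟩

theorem attach_injective [DecidableEq E] (M : E → Machine Empty) (κ : E → K) (e : E) :
    Injective (attach M κ e) := by
  intro a b h
  simp only [attach] at h
  split_ifs at h with ha hb hb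
  · rw [ha, hb]
  · simpa using h

variable [DecidableEq K] [Fintype E]

/-- Run a fragment, then continue with a machine that depends on the exit. -/
def Block.followedBy [DecidableEq E] (B : Block Empty K E) (κ : E → K) (M : E → Machine Empty) :
    Block Empty (K ⊕ Σ e, Option (M e).K) Bool :=
  (B.map id Sum.inl).bind fun e => (M e).toBlock.map id (attach M κ e)

theorem Block.Runs.followedBy [DecidableEq E] {B : Block Empty K E} {κ : E → K}
    {M : E → Machine Empty} {inp : K} {coins : ℕ → Bool} {x : List Bool} {T t : ℕ} {e : E}
    {m : Mem Empty K} {b : Bool} (h : B.Runs Empty.elim (Mem.init inp coins x) T e m)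
    (ht : (M e).instr ((M e).run Empty.elim m.coins (m.stk (κ e)) t).state = .halt b) :
    ∃ m', (B.followedBy κ M).Runs Empty.elim (Mem.init (Sum.inl inp) coins x) (T + t) b m' := by
  obtain ⟨d, hd⟩ := Machine.toBlock_runs (O' := Empty.elim) ht
  -- The fragment may leave garbage behind. The second machine still starts from a proper initial
  -- memory, since it shares only the stack `κ e` with the fragment and its other stacks are fresh.
  refine ⟨_, Block.Runs.bind (Block.Runs.map (O := Empty.elim) (i := id) Sum.inl_injective h _ []
    ?_ rfl rfl) (Block.Runs.map (O := Empty.elim) (i := id) (attach_injective M κ e) hd _ [] ?_ rfl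
      (Subsingleton.elim _ _))⟩
  · intro k
    simp [Mem.init, update_apply]
  · intro o
    by_cases ho : o = some (M e).inp
    · subst ho
      simp [attach, Mem.init, Sum.inl_injective.extend_apply]
    · simp [attach, Mem.init, ho]

variable [Fintype K]

/-- A predicate is in NP if it is decided by running a polynomial-time fragment and then checking
an NP predicate of some stack. -/
theorem IsNP.of_block (B : Block Empty K E) (inp : K) (κ : E → K) (N : E → List Bool → Prop)
    (hN : ∀ e, IsNP (N e)) (p : Polynomial ℕ)
    (hB : ∀ coins x, ∃ e m', B.Runs Empty.elim (Mem.init inp coins x) (p.eval x.length) e m') :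
    IsNP fun x => ∃ coins T e m', B.Runs Empty.elim (Mem.init inp coins x) T e m' ∧
      N e (m'.stk (κ e)) := by
  classical
  choose M hM hacc using hN
  choose q hq using hM
  -- After at most `p` steps the string handed over has length at most `|x| + p(|x|)`; summing over
  -- the exits `e` bounds all second phases at once.
  have total : ∀ coins x, ∃ e m m' t b, B.Runs Empty.elim (Mem.init inp coins x)
      (p.eval x.length) e m ∧
      (M e).instr ((M e).run Empty.elim m.coins (m.stk (κ e)) t).state = .halt b ∧
      (B.followedBy κ M).Runs Empty.elim (Mem.init (Sum.inl inp) coins x)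
        ((p + ∑ e, (q e).comp (Polynomial.X + p)).eval x.length) b m' := by
    intro coins x
    obtain ⟨e, m, hm⟩ := hB coins x
    obtain ⟨t, ht, b, hb⟩ := hq e Empty.elim m.coins (m.stk (κ e))
    obtain ⟨m', hm'⟩ := hm.followedBy hb
    refine ⟨e, m, m', t, b, hm, hb, hm'.mono ?_⟩
    rw [Polynomial.eval_add, Polynomial.eval_finsetSum]
    refine Nat.add_le_add_left (ht.trans ?_) _
    refine le_trans ?_ (Finset.single_le_sum (f := fun e => ((q e).comp
      (Polynomial.X + p)).eval x.length) (fun _ _ => Nat.zero_le _) (Finset.mem_univ e))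
    simp only [Polynomial.eval_comp, Polynomial.eval_add, Polynomial.eval_X]
    refine eval_mono (q e) ?_
    have := hm.length_le (κ e)
    have := Mem.length_init_le (ι := Empty) inp (κ e) coins x
    omega
  refine ⟨(B.followedBy κ M).toMachine (Sum.inl inp) (Sum.inl inp),
    ⟨p + ∑ e, (q e).comp (Polynomial.X + p), fun O coins x => ?_⟩, fun x => ⟨?_, ?_⟩⟩
  · obtain rfl : O = Empty.elim := Subsingleton.elim _ _
    obtain ⟨_, _, _, _, b, _, _, h⟩ := total coins x
    obtain ⟨t, ht, hr⟩ := h.run (inp := Sum.inl inp) (out := Sum.inl inp)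
    exact ⟨t, ht, b, by rw [hr]; rfl⟩
  · rintro ⟨coins, T, e, m, hm, hN⟩
    obtain ⟨c, t, ht⟩ := (hacc e _).1 hN
    -- The coins `c` of an accepting second phase are spliced behind those consumed by the fragment.
    obtain ⟨c', hc'⟩ := hm.recoin c
    obtain ⟨m', hm'⟩ := Block.Runs.followedBy (M := M) (m := ⟨m.stk, c, m.asked⟩) hc' ht
    obtain ⟨t', _, hr⟩ := Block.Runs.run (inp := Sum.inl inp) (out := Sum.inl inp) (coins := c') hm'
    exact ⟨c', t', by rw [hr]; rfl⟩
  · rintro ⟨coins, t, ht⟩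
    obtain ⟨e, m, m', s, b, hm, hb, h⟩ := total coins x
    obtain ⟨t', _, hr⟩ := h.run (inp := Sum.inl inp) (out := Sum.inl inp)
    obtain rfl : true = b := (Machine.run_eq_of_halt (b' := b) ht (by rw [hr]; rfl)).2
    exact ⟨coins, _, e, m, hm, (hacc e _).2 ⟨_, _, hb⟩⟩

/-- Here the check is equivalent to `P x` for every sequence of coins, so the existential quantifier
over coins in `IsNP.of_block` collapses. -/
theorem IsNP.of_det (B : Block Empty K E) (inp : K) (κ : E → K) (N : E → List Bool → Prop)
    (hN : ∀ e, IsNP (N e)) (p : Polynomial ℕ) {P : List Bool → Prop}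
    (hB : ∀ coins x, ∃ e m', B.Runs Empty.elim (Mem.init inp coins x) (p.eval x.length) e m' ∧
      (P x ↔ N e (m'.stk (κ e)))) :
    IsNP P := by
  refine (IsNP.of_block B inp κ N hN p fun coins x => ?_).congr fun x => ⟨fun h => ?_, ?_⟩
  · obtain ⟨e, m, hm, _⟩ := hB coins x
    exact ⟨e, m, hm⟩
  · obtain ⟨e, m, hm, hP⟩ := hB (fun _ => false) x
    exact ⟨_, _, e, m, hm, hP.1 h⟩
  · rintro ⟨coins, T, e, m, hm, hN⟩
    obtain ⟨e', m', hm', hP⟩ := hB coins x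
    obtain ⟨rfl, rfl⟩ := hm.unique hm'
    exact hP.2 hN

end ofBlock

/-! ### Closure properties -/

theorem IsNP.const (P : Prop) : IsNP fun _ => P := by
  classical
  refine ⟨(Block.ret (decide P) : Block Empty Unit Bool).toMachine () (), ⟨0, fun O coins x => ?_⟩,
    fun x => ?_⟩
  · exact ⟨0, by simp, decide P, rfl⟩
  · have h0 : ((Block.ret (decide P) : Block Empty Unit Bool).toMachine () ()).instr
      (((Block.ret (decide P) : Block Empty Unit Bool).toMachine () ()).run Empty.elim
        (fun _ => false) x 0).state = .halt (decide P) := rfl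
    constructor
    · intro h
      exact ⟨fun _ => false, 0, h0.trans (by simp [h])⟩
    · rintro ⟨coins, t, ht⟩
      have := (Machine.run_eq_of_halt (t := 0) (b := decide P) rfl ht).2
      simpa using this

/-- With `v` true or false this covers both `P` and its complement, so the values of finitely many P
predicates can be tested inside NP. -/
theorem IsP.isNP_eq {P : List Bool → Prop} (h : IsP P) (v : Prop) : IsNP fun x => P x ↔ v := by
  obtain ⟨K, _, _, B, inp, p, _, hB⟩ := h
  refine IsNP.of_det B inp (fun _ => inp) (fun b _ => b = true ↔ v) (fun b => .const _) p
    fun coins x => ?_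
  obtain ⟨b, m', hm, hP⟩ := hB coins x
  exact ⟨b, m', hm, by rw [hP]⟩

/-- One coin selects which of the two machines is run. -/
theorem IsNP.or {P P' : List Bool → Prop} (h : IsNP P) (h' : IsNP P') :
    IsNP fun x => P x ∨ P' x := by
  refine (IsNP.of_block (K := Unit) Block.guess () (fun _ => ()) (fun b => if b then P else P')
    (fun b => ?_) 1 fun coins x => ⟨_, _, (Block.runs_guess _).mono (by simp)⟩).congr
    fun x => ⟨?_, ?_⟩
  · cases b <;> simpa
  · rintro (hx | hx)
    · exact ⟨fun _ => true, _, _, _, Block.runs_guess _, by simpa [Mem.init]⟩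
    · exact ⟨fun _ => false, _, _, _, Block.runs_guess _, by simpa [Mem.init]⟩
  · rintro ⟨coins, T, b, m, hm, hx⟩
    obtain ⟨rfl, rfl⟩ := hm.unique (Block.runs_guess _)
    cases hc : (Mem.init () coins x : Mem Empty Unit).coins 0 <;> rw [hc] at hx <;>
      simp [Mem.init] at hx
    · exact .inr hx
    · exact .inl hx

theorem IsNP.exists {α : Type*} [Finite α] {P : α → List Bool → Prop} (h : ∀ a, IsNP (P a)) :
    IsNP fun x => ∃ a, P a x := by
  classical
  cases nonempty_fintype α
  have key : ∀ s : Finset α, IsNP fun x => ∃ a ∈ s, P a x := by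
    intro s
    induction s using Finset.induction_on with
    | empty => exact (IsNP.const False).congr (by simp)
    | insert a s _ ih => exact ((h a).or ih).congr (by simp)
  exact (key Finset.univ).congr (by simp)

/-- Tagging by a first bit. -/
theorem IsNP.cons {P : List Bool → Prop} (h : IsNP P) (b : Bool) :
    IsNP fun w => ∃ x, w = b :: x ∧ P x := by
  refine IsNP.of_det (K := Unit) (Block.pop ()) () (fun _ => ())
    (fun o x => if o = some b then P x else False) (fun o => ?_) 1
    fun coins x => ⟨_, _, (Block.runs_pop _ _).mono (by simp), ?_⟩
  · split_ifs
    · exact h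
    · exact .const _
  · rcases x with _ | ⟨a, x⟩ <;> simp [Mem.init, eq_comm]

/-! ### Moving strings between stacks -/

section strings

variable {ι K : Type} [DecidableEq K]

/-- The stacks after pushing a list of bits. -/
def pushAll (s : K → List Bool) (l : List (K × Bool)) : K → List Bool :=
  l.foldl (fun s p => update s p.1 (p.2 :: s p.1)) s

/-- The bits destined for stack `k`. -/
def bitsFor (k : K) (l : List (K × Bool)) : List Bool :=
  (l.filter fun p => p.1 = k).map Prod.snd

theorem bitsFor_eq_nil {k : K} {l : List (K × Bool)} (h : ∀ p ∈ l, p.1 ≠ k) : bitsFor k l = [] := by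
  simpa [bitsFor] using h

theorem pushAll_apply (s : K → List Bool) (l : List (K × Bool)) (k : K) :
    pushAll s l k = (bitsFor k l).reverse ++ s k := by
  induction l generalizing s with
  | nil => rfl
  | cons p l ih =>
    change pushAll _ l k = _
    rw [ih]
    by_cases hp : p.1 = k
    · subst hp
      simp [bitsFor]
    · have hp' : k ≠ p.1 := fun h => hp h.symm
      simp [bitsFor, hp, hp']

namespace Block

/-- Push a list of bits. -/
def pushL : List (K × Bool) → Block ι K Unit
  | [] => ret ()
  | p :: l => (push p.1 p.2).bind fun _ => pushL l

/-- The body of `Block.drain`. -/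
def drainBody (w : Bool → List (K × Bool)) : Option Bool → Block ι K (Option Unit)
  | none => ret (some ())
  | some b => (pushL (w b)).bind fun _ => ret none

/-- Empty stack `k` and push `w b` for every bit `b` of it. -/
def drain (k : K) (w : Bool → List (K × Bool)) : Block ι K Unit :=
  loop k (drainBody w)

/-- The body of `Block.unpair`. -/
def unpairBody (k : K) (w : Bool → List (K × Bool)) : Option Bool → Block ι K (Option Unit)
  | some true => (pop k).bind fun o => (pushL (w (o.getD false))).bind fun _ => ret none
  | _ => ret (some ())

/-- Remove the first component of a pair from stack `k` and push `w b` for every bit `b` of it. -/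
def unpair (k : K) (w : Bool → List (K × Bool)) : Block ι K Unit :=
  loop k (unpairBody k w)

omit [DecidableEq K] in
theorem det_pushL (l : List (K × Bool)) : (pushL l : Block ι K Unit).Det := by
  induction l with
  | nil => exact det_ret _
  | cons p l ih => exact (det_push _ _).bind fun _ => ih

omit [DecidableEq K] in
theorem det_drain (k : K) (w : Bool → List (K × Bool)) : (drain k w : Block ι K Unit).Det :=
  Det.loop fun o => by
    cases o with
    | none => exact det_ret _
    | some b => exact (det_pushL _).bind fun _ => det_ret _

omit [DecidableEq K] in
theorem det_unpair (k : K) (w : Bool → List (K × Bool)) : (unpair k w : Block ι K Unit).Det :=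
  Det.loop fun o => by
    rcases o with _ | _ | _
    · exact det_ret _
    · exact det_ret _
    · exact (det_pop _).bind fun _ => (det_pushL _).bind fun _ => det_ret _

variable {O : ι → Language Bool}

theorem runs_pushL (l : List (K × Bool)) (m : Mem ι K) :
    (pushL l).Runs O m l.length () { m with stk := pushAll m.stk l } := by
  induction l generalizing m with
  | nil => exact runs_ret _ _ _
  | cons p l ih =>
    exact ((runs_push p.1 p.2 m).bind (ih _)).mono (by simp [Nat.add_comm])

theorem runs_drain {k : K} {w : Bool → List (K × Bool)} (hw : ∀ b, ∀ p ∈ w b, p.1 ≠ k) {c : ℕ}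
    (hc : ∀ b, (w b).length ≤ c) (x : List Bool) (m : Mem ι K) (hm : m.stk k = x) :
    (drain k w).Runs O m (x.length * (c + 1) + 1) ()
      { m with stk := fun k' => if k' = k then [] else
        (x.flatMap fun b => bitsFor k' (w b)).reverse ++ m.stk k' } := by
  induction x generalizing m with
  | nil =>
    refine Runs.of_eq (Runs.loop_exit (C := drainBody w) (T := 0) (e := ())
      (m₁ := ⟨update m.stk k [], m.coins, m.asked⟩) ?_) (by simp) (fun k' => ?_) rfl rfl
    · rw [hm]
      exact runs_ret _ _ _
    · by_cases hk : k' = k <;> simp [hk]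
  | cons b x ih =>
    have h₁ := (runs_pushL (O := O) (w b) ⟨update m.stk k x, m.coins, m.asked⟩).bind
      (C := fun _ => ret (none : Option Unit)) (runs_ret none _ 0)
    have h₂ := ih ⟨pushAll (update m.stk k x) (w b), m.coins, m.asked⟩ (by
      simp [pushAll_apply, bitsFor_eq_nil (hw b)])
    refine Runs.of_eq (Runs.loop_next (C := drainBody w) (T := (w b).length + 0) ?_ h₂) ?_ (fun k' => ?_) rfl rfl
    · rw [hm]
      exact h₁
    · have := hc b
      simp only [List.length_cons, Nat.add_mul, Nat.mul_add]
      omega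
    · by_cases hk : k' = k <;> simp [hk, pushAll_apply]

theorem runs_unpair {k : K} {w : Bool → List (K × Bool)} (hw : ∀ b, ∀ p ∈ w b, p.1 ≠ k) {c : ℕ}
    (hc : ∀ b, (w b).length ≤ c) (x y : List Bool) (m : Mem ι K) (hm : m.stk k = pair x y) :
    (unpair k w).Runs O m (x.length * (c + 2) + 1) ()
      { m with stk := fun k' => if k' = k then y else
        (x.flatMap fun b => bitsFor k' (w b)).reverse ++ m.stk k' } := by
  induction x generalizing m with
  | nil =>
    refine Runs.of_eq (Runs.loop_exit (C := unpairBody k w) (T := 0) (e := ())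
      (m₁ := ⟨update m.stk k y, m.coins, m.asked⟩) ?_) (by simp) (fun k' => ?_) rfl rfl
    · rw [hm]
      exact runs_ret _ _ _
    · by_cases hk : k' = k <;> simp [hk]
  | cons b x ih =>
    have hm' : m.stk k = true :: b :: pair x y := hm
    have h₁ := (runs_pushL (O := O) (w b) ⟨update m.stk k (pair x y), m.coins, m.asked⟩).bind
      (C := fun _ => ret (none : Option Unit)) (runs_ret none _ 0)
    have h₀ := runs_pop (O := O) k ⟨update m.stk k (b :: pair x y), m.coins, m.asked⟩
    simp only [update_self, List.head?_cons, List.tail_cons, update_idem] at h₀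
    replace h₁ := h₀.bind
      (C := fun o => (pushL (w (o.getD false))).bind fun _ => ret (none : Option Unit)) h₁
    have h₂ := ih ⟨pushAll (update m.stk k (pair x y)) (w b), m.coins, m.asked⟩ (by
      simp [pushAll_apply, bitsFor_eq_nil (hw b)])
    refine Runs.of_eq (Runs.loop_next (C := unpairBody k w) (T := 1 + (w b).length) ?_ h₂) ?_ (fun k' => ?_) rfl rfl
    · rw [hm']
      exact h₁
    · have := hc b
      simp only [List.length_cons, Nat.add_mul, Nat.mul_add]
      omega
    · by_cases hk : k' = k <;> simp [hk, pushAll_apply]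

end Block

end strings

/-! ### Keeping a copy of the input -/

section dup

variable {ι K E : Type} [DecidableEq K]

/-- Run a fragment on a copy of the input, which comes on stack `inr 0` and is kept on stack
`inr 2`. -/
def Block.dup (B : Block Empty K E) (inp : K) : Block ι (K ⊕ Fin 4) E :=
  (drain (.inr 0) fun b => [(.inr 1, b)]).bind fun _ =>
    (drain (.inr 1) fun b => [(.inr 2, b), (.inl inp, b)]).bind fun _ =>
      B.map Empty.elim Sum.inl

omit [DecidableEq K] in
theorem Block.Det.dup {B : Block Empty K E} (h : B.Det) (inp : K) :
    (B.dup inp : Block ι _ E).Det :=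
  (det_drain _ _).bind fun _ => (det_drain _ _).bind fun _ => h.map _ _

theorem Block.Runs.dup {O : ι → Language Bool} {B : Block Empty K E} {inp : K}
    {coins : ℕ → Bool} {x : List Bool} {T : ℕ} {e : E} {m : Mem Empty K}
    (h : B.Runs Empty.elim (Mem.init inp coins x) T e m) :
    (B.dup inp).Runs O (Mem.init (.inr 0) coins x) (5 * x.length + 2 + T) e
      ⟨Sum.elim m.stk fun r => if r = 2 then x else [], m.coins, []⟩ := by
  have h₁ : (drain (.inr 0) fun b => [(.inr 1, b)]).Runs O
      (Mem.init (Sum.inr 0 : K ⊕ Fin 4) coins x) (x.length * 2 + 1) ()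
      ⟨Sum.elim (fun _ => []) fun r => if r = 1 then x.reverse else [], coins, []⟩ := by
    refine (runs_drain (by simp) (c := 1) (by simp) x _ (by simp [Mem.init])).of_eq le_rfl ?_ rfl rfl
    rintro (k | r)
    · simp [bitsFor, Mem.init]
    · fin_cases r <;> simp [bitsFor, Mem.init]
  have h₂ : (drain (.inr 1) fun b => [(.inr 2, b), (.inl inp, b)]).Runs O
      ⟨Sum.elim (fun _ => []) fun r => if r = 1 then x.reverse else [], coins, []⟩
      (x.length * 3 + 1) () (⟨Sum.elim (update (fun _ => []) inp x) fun r => if r = 2 then x else [],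
        coins, []⟩ : Mem ι (K ⊕ Fin 4)) := by
    refine (runs_drain (by simp) (c := 2) (by simp) x.reverse _ (by simp)).of_eq (by simp) ?_ rfl rfl
    rintro (k | r)
    · by_cases hk : inp = k
      · simp [bitsFor, hk]
      · simp [bitsFor, hk, Ne.symm hk]
    · fin_cases r <;> simp [bitsFor]
  have hO : (Empty.elim : Empty → Language Bool) = O ∘ Empty.elim := Subsingleton.elim _ _
  rw [hO] at h
  have h₃ := h.map (O := O) Sum.inl_injective
    (⟨Sum.elim (update (fun _ => []) inp x) fun r => if r = 2 then x else [], coins, []⟩ :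
      Mem ι (K ⊕ Fin 4)) [] (by simp [Mem.init]) rfl rfl
  have h₄ := h₂.bind (C := fun _ => B.map Empty.elim Sum.inl) h₃
  have h₅ := h₁.bind (C := fun _ =>
    (drain (.inr 1) fun b => [(.inr 2, b), (.inl inp, b)]).bind fun _ => B.map Empty.elim Sum.inl) h₄
  refine Runs.of_eq (B := B.dup inp) h₅ (by omega) (fun k => ?_) rfl ?_
  · rcases k with k | r
    · exact Sum.inl_injective.extend_apply _ _ _
    · exact extend_apply' _ _ _ (by simp)
  · simp [Subsingleton.elim m.asked []]

end dup

/-- NP is closed under conjunction. -/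
theorem IsNP.and {P P' : List Bool → Prop} (h : IsNP P) (h' : IsNP P') :
    IsNP fun x => P x ∧ P' x := by
  obtain ⟨M, ⟨p, hM⟩, hP⟩ := h
  -- The machine for `P` works on a copy, so that after acceptance the untouched input on stack `inr
  -- 2` can be passed to the check of `P'`.
  have run : ∀ coins x, ∃ t b, M.instr (M.run Empty.elim coins x t).state = .halt b ∧
      ∃ m', m'.stk (.inr 2) = x ∧ (M.toBlock.dup (some M.inp)).Runs Empty.elim
        (Mem.init (.inr 0) coins x) ((p + 5 * Polynomial.X + 2).eval x.length) b m' := by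
    intro coins x
    obtain ⟨t, ht, b, hb⟩ := hM Empty.elim coins x
    obtain ⟨d, hd⟩ := Machine.toBlock_runs (O' := Empty.elim) hb
    refine ⟨t, b, hb, _, ?_, hd.dup.mono ?_⟩
    · simp
    · simp
      omega
  refine (IsNP.of_block (M.toBlock.dup (some M.inp)) (.inr 0) (fun _ => .inr 2)
    (fun b => if b then P' else fun _ => False) (fun b => ?_) (p + 5 * Polynomial.X + 2)
    fun coins x => ?_).congr fun x => ⟨?_, ?_⟩
  · cases b
    · exact .const _
    · exact h'
  · obtain ⟨_, b, _, m', _, hr⟩ := run coins x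
    exact ⟨b, m', hr⟩
  · rintro ⟨hx, hx'⟩
    obtain ⟨coins, t, ht⟩ := (hP x).1 hx
    obtain ⟨t', b, hb, m', hm', hr⟩ := run coins x
    obtain rfl := (Machine.run_eq_of_halt hb ht).2
    exact ⟨coins, _, true, m', hr, by simpa [hm']⟩
  · rintro ⟨coins, T, b, m, hm, hx⟩
    obtain ⟨t, b', hb, m', hm', hr⟩ := run coins x
    obtain ⟨rfl, rfl⟩ := hm.unique hr
    cases b
    · exact hx.elim
    · exact ⟨(hP x).2 ⟨coins, t, hb⟩, by simpa [hm'] using hx⟩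

theorem IsNP.forall {α : Type*} [Finite α] {P : α → List Bool → Prop} (h : ∀ a, IsNP (P a)) :
    IsNP fun x => ∀ a, P a x := by
  classical
  cases nonempty_fintype α
  have key : ∀ s : Finset α, IsNP fun x => ∀ a ∈ s, P a x := by
    intro s
    induction s using Finset.induction_on with
    | empty => exact (IsNP.const True).congr (by simp)
    | insert a s _ ih => exact ((h a).and ih).congr (by simp)
  exact (key Finset.univ).congr (by simp)

/-! ### Ranks with NP superlevel sets -/

/-- All superlevel sets of `N` are in NP. -/
def NPRank (N : List Bool → ℕ) : Prop :=
  ∀ c, IsNP fun x => c < N x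

/-- The set `{n | c < φ n}` is upward closed, hence empty or of the form `{n | d ≤ n}`. -/
theorem NPRank.comp {N : List Bool → ℕ} (h : NPRank N) {φ : ℕ → ℕ} (hφ : Monotone φ) :
    NPRank fun x => φ (N x) := by
  classical
  intro c
  by_cases hc : ∃ n, c < φ n
  · have hiff : ∀ n, c < φ n ↔ Nat.find hc ≤ n := fun n =>
      ⟨fun hn => Nat.find_le hn, fun hn => (Nat.find_spec hc).trans_le (hφ hn)⟩
    rcases hd : Nat.find hc with _ | d
    · exact (IsNP.const True).congr fun x => by rw [hiff, hd]; simp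
    · exact (h d).congr fun x => by rw [hiff, hd]; rfl
  · push Not at hc
    exact (IsNP.const False).congr fun x => by simpa using hc _

theorem NPRank.isNP_le {N : List Bool → ℕ} (h : NPRank N) (c : ℕ) : IsNP fun x => c ≤ N x := by
  cases c with
  | zero => exact (IsNP.const True).congr fun x => by simp
  | succ c => exact h c

/-- For `A \ B` the rank is one more than that of `B` on `A`, and `0` off `A`, which flips the
parity exactly on `A`. Conversely, peel off `A = {N > 0}` and continue with `N - 1`. -/
theorem mem_BH_iff {k : ℕ} (hk : 1 ≤ k) {L : Language Bool} :
    L ∈ BH k ↔ ∃ N, NPRank N ∧ (∀ x, N x ≤ k) ∧ ∀ x, x ∈ L ↔ Odd (N x) := by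
  classical
  induction k, hk using Nat.le_induction generalizing L with
  | base =>
    constructor
    · intro h
      refine ⟨fun x => if x ∈ L then 1 else 0, fun c => ?_, fun x => ?_, fun x => ?_⟩
      · cases c with
        | zero => exact IsNP.congr (P := (· ∈ L)) h fun x => by by_cases hx : x ∈ L <;> simp [hx]
        | succ c => exact (IsNP.const False).congr fun x => by by_cases hx : x ∈ L <;> simp [hx]
      · dsimp only
        split_ifs <;> simp
      · by_cases hx : x ∈ L <;> simp [hx]
    · rintro ⟨N, hN, hle, hL⟩
      refine IsNP.congr (P' := (· ∈ L)) (hN 0) fun x => ?_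
      have := hle x
      rw [hL]
      interval_cases N x <;> simp
  | succ k hk ih =>
    -- Makes the level `k' + 2`, where `BH` unfolds to a difference by definition.
    obtain ⟨k, rfl⟩ : ∃ k', k = k' + 1 := ⟨k - 1, by omega⟩
    constructor
    · rintro ⟨A, hA, B, hB, rfl⟩
      obtain ⟨N, hN, hle, hBN⟩ := ih.1 hB
      refine ⟨fun x => if x ∈ A then N x + 1 else 0, fun c => ?_, fun x => ?_, fun x => ?_⟩
      · cases c with
        | zero => exact IsNP.congr (P := (· ∈ A)) hA fun x => by by_cases hx : x ∈ A <;> simp [hx]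
        | succ c =>
          exact IsNP.congr (IsNP.and (P := (· ∈ A)) hA (hN c)) fun x => by
            by_cases hx : x ∈ A <;> simp [hx]
      · have := hle x
        dsimp only
        split_ifs <;> omega
      · change x ∈ A ∧ x ∉ B ↔ _
        by_cases hx : x ∈ A <;> simp [hx, hBN, Nat.odd_add_one]
    · rintro ⟨N, hN, hle, hL⟩
      refine ⟨{x | 0 < N x}, hN 0, {x | Odd (N x - 1)}, ih.2 ⟨fun x => N x - 1, ?_, ?_, ?_⟩, ?_⟩
      · exact hN.comp fun a b h => Nat.sub_le_sub_right h 1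
      · intro x
        have := hle x
        dsimp only
        omega
      · exact fun x => Iff.rfl
      · ext x
        change x ∈ L ↔ 0 < N x ∧ ¬ Odd (N x - 1)
        rw [hL, Nat.odd_iff, Nat.odd_iff]
        omega

/-- Normal form of the languages decided with at most `m` mind changes: a polynomial-time initial
guess, which is reversed `N x` times. -/
def MindChanges (m : ℕ) (P : List Bool → Prop) : Prop :=
  ∃ F, IsP F ∧ ∃ N, NPRank N ∧ (∀ x, N x ≤ m) ∧ ∀ x, P x ↔ (F x ↔ Even (N x))

/-! ### Alternation in finite posets -/

section alternation

variable {X : Type*} [PartialOrder X] [OrderBot X]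

/-- `s` ends a chain from `⊥` along which `F` changes its value `c` times. -/
inductive Alternates (F : X → Prop) : ℕ → X → Prop
  | bot : Alternates F 0 ⊥
  | change {c : ℕ} {s t : X} : Alternates F c s → s ≤ t → ¬ (F s ↔ F t) → Alternates F (c + 1) t

theorem Alternates.iff_even {F : X → Prop} {c : ℕ} {s : X} (h : Alternates F c s) :
    F s ↔ (F ⊥ ↔ Even c) := by
  induction h with
  | bot => simp
  | change _ _ hF ih =>
    rw [Nat.even_add_one]
    tauto

/-- A strictly monotone function bounds the number of changes. -/
theorem Alternates.le {F : X → Prop} {ρ : X → ℕ} (hρ : ∀ s t, s ≤ t → ¬ (F s ↔ F t) → ρ s < ρ t)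
    {c : ℕ} {s : X} (h : Alternates F c s) : c ≤ ρ s := by
  induction h with
  | bot => exact Nat.zero_le _
  | change _ hle hF ih => exact ih.trans_lt (hρ _ _ hle hF)

open scoped Classical in
/-- The maximal number of changes of `F` on a chain from `⊥` to `s`, if at most `m`. -/
noncomputable def depth (m : ℕ) (F : X → Prop) (s : X) : ℕ :=
  Nat.findGreatest (fun c => ∃ s' ≤ s, Alternates F c s') m

/-- In this existential form the condition is visibly monotone in `s`, so NP knowledge of the points
below `s` suffices to verify it. -/
theorem lt_depth_iff {m : ℕ} {F : X → Prop} {s : X} {c : ℕ} :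
    c < depth m F s ↔ ∃ c' ≤ m, c < c' ∧ ∃ s' ≤ s, Alternates F c' s' := by
  classical
  constructor
  · intro h
    exact ⟨_, Nat.findGreatest_le m, h, Nat.findGreatest_of_ne_zero (P := fun c => ∃ s' ≤ s,
      Alternates F c s') rfl (by unfold depth at h; omega)⟩
  · rintro ⟨c', hm, hc, hs⟩
    exact hc.trans_le (Nat.le_findGreatest hm hs)

theorem depth_le (m : ℕ) (F : X → Prop) (s : X) : depth m F s ≤ m := by
  classical
  exact Nat.findGreatest_le m

/-- A chain realising the depth ends at some `s' ≤ s` and cannot be prolonged to `s`, so `F` agrees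
at `s'` and `s`. By `hm` the cut-off at `m` in `depth` loses nothing. -/
theorem iff_even_depth {m : ℕ} {F : X → Prop} (hm : ∀ c s, Alternates F c s → c ≤ m) (s : X) :
    F s ↔ (F ⊥ ↔ Even (depth m F s)) := by
  classical
  obtain ⟨s', hs', h⟩ : ∃ s' ≤ s, Alternates F (depth m F s) s' :=
    Nat.findGreatest_spec (P := fun c => ∃ s' ≤ s, Alternates F c s') (Nat.zero_le m)
      ⟨⊥, bot_le, .bot⟩
  rw [← h.iff_even]
  by_contra hF
  have h' := h.change hs' fun h' => hF h'.symm
  have : depth m F s + 1 ≤ depth m F s := Nat.le_findGreatest (hm _ _ h') ⟨s, le_rfl, h'⟩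
  omega

/-- The reversal count is the depth of `σ x`. It exceeds `c` iff some `γ` and `s` satisfy `g x = γ`,
`s ≤ σ x` and a condition independent of `x`: a finite disjunction of NP predicates. -/
theorem MindChanges.of_alternation [Finite X] {Γ : Type*} [Finite Γ] {σ : List Bool → X}
    (hσ : ∀ s, IsNP fun x => s ≤ σ x) {g : List Bool → Γ} (hg : ∀ γ, IsNP fun x => g x = γ)
    {F : Γ → X → Prop} (hF : IsP fun x => F (g x) ⊥) {m : ℕ}
    (hm : ∀ γ c s, Alternates (F γ) c s → c ≤ m) :
    MindChanges m fun x => F (g x) (σ x) := by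
  refine ⟨_, hF, fun x => depth m (F (g x)) (σ x), fun c => ?_, fun x => depth_le _ _ _,
    fun x => iff_even_depth (hm _) _⟩
  refine (IsNP.exists fun γ => IsNP.exists fun s => ((hg γ).and (hσ s)).and
    (IsNP.const (∃ c' ≤ m, c < c' ∧ Alternates (F γ) c' s))).congr fun x => ?_
  rw [lt_depth_iff]
  constructor
  · rintro ⟨c', hc', hlt, s, hs, h⟩
    exact ⟨_, s, ⟨rfl, hs⟩, c', hc', hlt, h⟩
  · rintro ⟨γ, s, ⟨rfl, hs⟩, c', hc', hlt, h⟩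
    exact ⟨c', hc', hlt, s, hs, h⟩

end alternation

/-! ### Truth-table reductions have few mind changes -/

section parse

variable {ι K : Type}

namespace Block

/-- Remove the first components of `n` nested pairs from stack `k`. -/
def skip (k : K) : ℕ → Block ι K Unit
  | 0 => ret ()
  | n + 1 => (unpair k fun _ => []).bind fun _ => skip k n

/-- Remove `n` bits from stack `k`. -/
def popN (k : K) : ℕ → Block ι K Unit
  | 0 => ret ()
  | n + 1 => (pop k).bind fun _ => popN k n

theorem det_skip (k : K) (n : ℕ) : (skip k n : Block ι K Unit).Det := by
  induction n with
  | zero => exact det_ret _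
  | succ n ih => exact (det_unpair _ _).bind fun _ => ih

theorem det_popN (k : K) (n : ℕ) : (popN k n : Block ι K Unit).Det := by
  induction n with
  | zero => exact det_ret _
  | succ n ih => exact (det_pop _).bind fun _ => ih

theorem length_pair (x y : List Bool) : (pair x y).length = 2 * x.length + 1 + y.length := by
  induction x with
  | nil => simp [pair, Nat.add_comm]
  | cons b x ih =>
    have : pair (b :: x) y = true :: b :: pair x y := rfl
    rw [this, List.length_cons, List.length_cons, ih, List.length_cons]
    omega

variable [DecidableEq K] {O : ι → Language Bool}

theorem runs_skip {k : K} (l : List (List Bool)) (w : List Bool) (n : ℕ) (hn : n ≤ l.length)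
    (m : Mem ι K) (hm : m.stk k = l.foldr pair w) :
    (skip k n).Runs O m (l.foldr pair w).length ()
      { m with stk := update m.stk k ((l.drop n).foldr pair w) } := by
  induction n generalizing l m with
  | zero =>
    refine (runs_ret () m _).of_eq le_rfl (fun k' => ?_) rfl rfl
    by_cases hk : k' = k
    · subst hk
      simpa using hm
    · simp [hk]
  | succ n ih =>
    rcases l with _ | ⟨x, l⟩
    · simp at hn
    · have h₁ := runs_unpair (O := O) (k := k) (w := fun _ => []) (by simp) (c := 0) (by simp) x
        (l.foldr pair w) m hm
      refine (h₁.bind (C := fun _ => skip k n) (ih l (by simpa using hn) _ (by simp))).of_eq ?_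
        (fun k' => ?_) rfl rfl
      · simp only [List.foldr_cons, length_pair]
        omega
      · by_cases hk : k' = k <;> simp [hk, bitsFor]

theorem runs_popN (k : K) (n : ℕ) (m : Mem ι K) :
    (popN k n).Runs O m n () { m with stk := update m.stk k ((m.stk k).drop n) } := by
  induction n generalizing m with
  | zero => exact (runs_ret () m _).of_eq le_rfl (fun k' => by simp) rfl rfl
  | succ n ih =>
    exact ((runs_pop k m).bind (C := fun _ => popN k n) (ih _)).of_eq (by omega)
      (fun k' => by simp) rfl rfl

end Block

end parse

theorem encodeTT_length_ge {m : ℕ} (y : Fin m → List Bool) (α : (Fin m → Bool) → Bool) (i : Fin m) :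
    2 * (y i).length ≤ (encodeTT y α).length := by
  have : ∀ (l : List (List Bool)) (w x : List Bool), x ∈ l →
      2 * x.length ≤ (l.foldr pair w).length := by
    intro l w x hx
    induction l with
    | nil => simp at hx
    | cons z l ih =>
      rw [List.foldr_cons, Block.length_pair]
      rcases List.mem_cons.1 hx with rfl | hx
      · omega
      · have := ih hx
        omega
  exact this _ _ _ (by simp)

theorem PolyTimeComputable.exists_runs {f : List Bool → List Bool} (h : PolyTimeComputable f) :
    ∃ (M : Machine Empty) (p : Polynomial ℕ), M.Deterministic ∧ ∀ coins x, ∃ b m',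
      (M.toBlock : Block Empty _ Bool).Runs Empty.elim (Mem.init (some M.inp) coins x)
        (p.eval x.length) b m' ∧ m'.stk (some M.out) = f x ∧
      (f x).length ≤ x.length + p.eval x.length := by
  obtain ⟨M, hdet, ⟨p, hp⟩, hf⟩ := h
  refine ⟨M, p, hdet, fun coins x => ?_⟩
  obtain ⟨t, ht, b, hb⟩ := hp Empty.elim coins x
  obtain ⟨t', b', hb', hout⟩ := hf coins x
  obtain ⟨d, hd⟩ := Machine.toBlock_runs (O' := Empty.elim) hb
  have hf' : ((M.run Empty.elim coins x t).mem d [] : Mem Empty _).stk (some M.out) = f x := by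
    rw [(Machine.run_eq_of_halt hb hb').1, ← hout]
    rfl
  refine ⟨b, _, hd.mono ht, hf', ?_⟩
  have := (hd.mono ht).length_le (some M.out)
  rw [hf'] at this
  have := Mem.length_init_le (ι := Empty) (some M.inp) (some M.out) coins x
  omega

theorem isP_truthTable {m : ℕ} {y : List Bool → Fin m → List Bool}
    {α : List Bool → (Fin m → Bool) → Bool}
    (h : PolyTimeComputable fun x => encodeTT (y x) (α x)) (v : Fin m → Bool) :
    IsP fun x => α x v = true := by
  obtain ⟨M, p, hdet, hM⟩ := h.exists_runs
  -- The value at `v` is bit number `n` of the truth table, which is what remains of the code once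
  -- the `m` strings are skipped.
  obtain ⟨n, hn, hv⟩ : ∃ n < 2 ^ m, (fun i : Fin m => n.testBit i) = v :=
    ⟨Nat.ofBits v, Nat.ofBits_lt_two_pow v, by
      funext i
      simp [Nat.testBit_ofBits_lt]⟩
  let B : Block Empty (Option M.K) Bool := M.toBlock.bind fun _ =>
    (Block.skip (some M.out) m).bind fun _ => (Block.popN (some M.out) n).bind fun _ =>
      (Block.pop (some M.out)).bind fun o => Block.ret (o.getD false)
  refine ⟨Option M.K, inferInstance, inferInstance, B, some M.inp, 2 * p + Polynomial.X + ((n + 1 : ℕ) : Polynomial ℕ),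
    ?_, fun coins x => ?_⟩
  · exact hdet.toBlock.bind fun _ => (Block.det_skip _ _).bind fun _ =>
      (Block.det_popN _ _).bind fun _ => (Block.det_pop _).bind fun _ => Block.det_ret _
  · obtain ⟨b, m', hr, hout, hlen⟩ := hM coins x
    have h₁ := Block.runs_skip (O := Empty.elim) (List.ofFn (y x)) (truthTable (α x)) m (by simp) m'
      hout
    have h₂ := hr.bind (C := fun _ => (Block.skip (some M.out) m).bind fun _ =>
      (Block.popN (some M.out) n).bind fun _ =>
      (Block.pop (some M.out)).bind fun o => Block.ret (o.getD false)) (h₁.bind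
      (C := fun _ => (Block.popN (some M.out) n).bind fun _ =>
        (Block.pop (some M.out)).bind fun o => Block.ret (o.getD false))
      ((Block.runs_popN _ n _).bind (C := fun _ =>
        (Block.pop (some M.out)).bind fun o => Block.ret (o.getD false))
        ((Block.runs_pop _ _).bind (C := fun o => Block.ret (o.getD false))
        (Block.runs_ret _ _ 0))))
    refine ⟨_, _, h₂.mono ?_, ?_⟩
    · have : ((List.ofFn (y x)).foldr pair (truthTable (α x))).length ≤
        x.length + p.eval x.length := hlen
      simp
      omega
    · have : (List.ofFn (y x)).drop m = [] := by simp
      simp [this, truthTable, hn, hv]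

/-- Extract the string number `i` from the code on stack `k` to stack `r₁`, using stack `r₀`. -/
def Block.component {ι K : Type} (k r₀ r₁ : K) (i : ℕ) : Block ι K Unit :=
  (skip k i).bind fun _ => (unpair k fun b => [(r₀, b)]).bind fun _ => drain r₀ fun b => [(r₁, b)]

/-- Unpairing onto `r₀` reverses the string; draining it to `r₁` restores the order. -/
theorem Block.runs_component {ι K : Type} [DecidableEq K] {O : ι → Language Bool} {k r₀ r₁ : K}
    (h₀ : r₀ ≠ k) (h₁ : r₁ ≠ k) (h₂ : r₁ ≠ r₀) {m : ℕ} (y : Fin m → List Bool)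
    (α : (Fin m → Bool) → Bool) (i : Fin m) (c : Mem ι K) (hc : c.stk k = encodeTT y α)
    (hr₀ : c.stk r₀ = []) (hr₁ : c.stk r₁ = []) :
    ∃ c', (component k r₀ r₁ i).Runs O c (4 * (encodeTT y α).length + 2) () c' ∧
      c'.stk r₁ = y i := by
  obtain ⟨w, hdrop⟩ : ∃ w, ((List.ofFn y).drop i).foldr pair (truthTable α) = pair (y i) w := by
    rw [List.drop_eq_getElem_cons (by simp)]
    exact ⟨_, by simp; rfl⟩
  have s₁ := runs_skip (O := O) (List.ofFn y) (truthTable α) i (by simp) c hc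
  rw [hdrop] at s₁
  have s₂ := runs_unpair (O := O) (w := fun b => [(r₀, b)]) (by simp [h₀]) (c := 1) (by simp) (y i)
    w ⟨update c.stk k (pair (y i) w), c.coins, c.asked⟩ (update_self _ _ _)
  have s₃ := runs_drain (O := O) (w := fun b => [(r₁, b)]) (by simp [h₂]) (c := 1) (by simp)
    (y i).reverse ⟨fun k' => if k' = k then w else
      ((y i).flatMap fun b => bitsFor k' [(r₀, b)]).reverse ++ update c.stk k (pair (y i) w) k',
      c.coins, c.asked⟩
    (k := r₀) (by simp [bitsFor, h₀, hr₀])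
  have s₄ := s₂.bind (C := fun _ => drain r₀ fun b => [(r₁, b)]) s₃
  have s₅ := s₁.bind (C := fun _ => (unpair k fun b => [(r₀, b)]).bind fun _ =>
    drain r₀ fun b => [(r₁, b)]) s₄
  refine ⟨_, s₅.mono ?_, ?_⟩
  · have := encodeTT_length_ge y α i
    have : ((List.ofFn y).foldr pair (truthTable α)).length = (encodeTT y α).length := rfl
    simp only [List.length_reverse]
    omega
  · simp [bitsFor, h₁, h₂, h₂.symm, hr₁]

theorem isNP_query {m : ℕ} {y : List Bool → Fin m → List Bool}
    {α : List Bool → (Fin m → Bool) → Bool}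
    (h : PolyTimeComputable fun x => encodeTT (y x) (α x)) {N : List Bool → Prop} (hN : IsNP N)
    (i : Fin m) : IsNP fun x => N (y x i) := by
  obtain ⟨M, p, hdet, hM⟩ := h.exists_runs
  refine IsNP.of_det ((M.toBlock.map id Sum.inl).bind fun _ =>
    Block.component (.inl (some M.out) : Option M.K ⊕ Fin 2) (.inr 0) (.inr 1) i)
    (.inl (some M.inp)) (fun _ => .inr 1) (fun _ => N) (fun _ => hN)
    (5 * p + 4 * Polynomial.X + 2) fun coins x => ?_
  obtain ⟨b, m', hr, hout, hlen⟩ := hM coins x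
  have h₀ := hr.map (O := Empty.elim) (i := id) Sum.inl_injective
    (Mem.init (.inl (some M.inp) : Option M.K ⊕ Fin 2) coins x) []
    (by simp [Mem.init, update_apply]) rfl rfl
  have hempty : ∀ r, extend Sum.inl m'.stk
      (Mem.init (.inl (some M.inp) : Option M.K ⊕ Fin 2) coins x : Mem Empty _).stk (.inr r) =
        [] := by
    intro r
    rw [extend_apply' _ _ _ (by simp)]
    simp [Mem.init]
  obtain ⟨c', h₁, hc'⟩ := Block.runs_component (O := Empty.elim) (k := .inl (some M.out))
    (r₀ := .inr 0) (r₁ := .inr 1) (by simp) (by simp) (by simp) (y x) (α x) i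
    ⟨extend Sum.inl m'.stk _, m'.coins, _⟩ ((Sum.inl_injective.extend_apply _ _ _).trans hout)
    (hempty 0) (hempty 1)
  refine ⟨(), c', (h₀.bind (C := fun _ => Block.component _ _ _ _) h₁).mono ?_, by rw [hc']⟩
  simp
  omega

theorem MindChanges.of_RTT {m : ℕ} {L : Language Bool} (h : L ∈ RTT m NP) :
    MindChanges m (· ∈ L) := by
  classical
  obtain ⟨B, hB, y, α, hf, hL⟩ := h
  -- The poset is that of answer vectors, and `γ` runs over all `m`-ary predicates.
  have hX := MindChanges.of_alternation (X := Fin m → Bool) (m := m)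
    (σ := fun x i => decide (y x i ∈ B)) (g := α) (F := fun γ v => γ v = true) ?_ ?_ ?_ ?_
  · obtain ⟨F, hF, N, hN, hle, hiff⟩ := hX
    exact ⟨F, hF, N, hN, hle, fun x => (hL x).trans (hiff x)⟩
  · intro s
    refine (IsNP.forall fun i => IsNP.congr (P' := fun x => s i ≤ decide (y x i ∈ B)) ?_
      fun x => Iff.rfl).congr fun x => Iff.rfl
    cases hs : s i with
    | false => exact (IsNP.const True).congr fun x => by simp
    | true =>
      exact (isNP_query hf (N := (· ∈ B)) hB i).congr fun x => by
        by_cases hx : y x i ∈ B <;> simp [hx]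
  · intro γ
    refine (IsNP.forall fun v => (isP_truthTable hf v).isNP_eq (γ v = true)).congr fun x => ?_
    rw [funext_iff]
    exact forall_congr' fun v => Bool.eq_iff_iff
  · exact isP_truthTable hf _
  · intro γ c s h
    -- Each change of value needs a strictly larger answer vector, hence one more yes.
    refine (h.le (ρ := fun s => (Finset.univ.filter fun i => s i = true).card) ?_).trans ?_
    · intro s t hst hne
      refine Finset.card_lt_card ⟨fun i => ?_, fun hsub => hne ?_⟩
      · simp only [Finset.mem_filter, Finset.mem_univ, true_and]
        exact fun hi => Bool.eq_true_of_true_le (hi ▸ hst i)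
      · have : s = t := by
          refine le_antisymm hst fun i => ?_
          cases ht : t i with
          | false => exact Bool.false_le _
          | true =>
            have := hsub (Finset.mem_filter.2 ⟨Finset.mem_univ i, ht⟩)
            simp only [Finset.mem_filter, Finset.mem_univ, true_and] at this
            rw [this]
        rw [this]
    · exact (Finset.card_le_univ _).trans (by simp)

/-! ### Two queries have few mind changes -/

namespace Machine

section runs

variable {ι : Type} {M : Machine ι}

/-- The coins do not matter for a deterministic machine. -/
theorem Deterministic.run_coins (h : M.Deterministic) (O : ι → Language Bool) (c c' : ℕ → Bool)
    (x : List Bool) (t : ℕ) :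
    M.run O c x t = { M.run O c' x t with coins := c } := by
  induction t with
  | zero => rfl
  | succ t ih =>
    rw [run_succ, run_succ, ih]
    generalize M.run O c' x t = d
    unfold step
    simp only
    cases hi : M.instr d.state with
    | guess n => exact absurd hi (h _ _)
    | _ => rfl

/-- Agreement is required only on the strings asked about along this run; so the true oracles can be
exchanged for constant ones. -/
theorem run_congr {O O' : ι → Language Bool} {c : ℕ → Bool} {x : List Bool} {t : ℕ}
    (h : ∀ s < t, ∀ i k n, M.instr (M.run O c x s).state = .query i k n →
      ((M.run O c x s).stk k ∈ O i ↔ (M.run O c x s).stk k ∈ O' i)) :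
    M.run O' c x t = M.run O c x t := by
  induction t with
  | zero => rfl
  | succ t ih =>
    rw [run_succ, run_succ, ih fun s hs => h s (by omega)]
    have ht := h t (by omega)
    generalize M.run O c x t = d at ht
    unfold step
    cases hi : M.instr d.state with
    | query i k n =>
      refine congrArg (fun b => (⟨n b, d.stk, d.coins, d.asked ++ [i]⟩ : M.Cfg)) ?_
      exact decide_eq_decide.2 (ht i k n hi).symm
    | _ => rfl

theorem asked_prefix (O : ι → Language Bool) (c : ℕ → Bool) (x : List Bool) {s t : ℕ}
    (hst : s ≤ t) : (M.run O c x s).asked <+: (M.run O c x t).asked := by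
  induction hst with
  | refl => exact List.prefix_refl _
  | @step t _ ih =>
    refine ih.trans ?_
    rw [run_succ]
    generalize M.run O c x t = d
    unfold step
    cases hi : M.instr d.state <;> simp

theorem asked_query {O : ι → Language Bool} {c : ℕ → Bool} {x : List Bool} {s : ℕ} {i : ι} {k : M.K}
    {n : Bool → M.Q} (h : M.instr (M.run O c x s).state = .query i k n) :
    (M.run O c x (s + 1)).asked = (M.run O c x s).asked ++ [i] := by
  rw [run_succ]
  unfold step
  rw [h]

end runs

section twoQueries

variable {M : Machine (Fin 2)}

/-- The first query to oracle `i` is about the string `y`. -/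
def FirstQuery (M : Machine (Fin 2)) (O : Fin 2 → Language Bool) (i : Fin 2) (x y : List Bool) :
    Prop :=
  ∃ t k n, M.instr (M.run O (fun _ => false) x t).state = .query i k n ∧
    (M.run O (fun _ => false) x t).stk k = y ∧
    ∀ s < t, ∀ k n, M.instr (M.run O (fun _ => false) x s).state ≠ .query i k n

theorem FirstQuery.unique {O : Fin 2 → Language Bool} {i : Fin 2} {x y y' : List Bool}
    (h : M.FirstQuery O i x y) (h' : M.FirstQuery O i x y') : y = y' := by
  obtain ⟨t, k, n, ht, rfl, hs⟩ := h
  obtain ⟨t', k', n', ht', rfl, hs'⟩ := h'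
  obtain rfl : t = t' := by
    rcases lt_trichotomy t t' with hlt | heq | hlt
    · exact absurd ht (hs' t hlt k n)
    · exact heq
    · exact absurd ht' (hs t' hlt k' n')
  cases ht.symm.trans ht'
  rfl

open scoped Classical in
/-- The rank of the string about which oracle `i` is asked first. -/
noncomputable def queryRank (M : Machine (Fin 2)) (O : Fin 2 → Language Bool) (i : Fin 2)
    (N : List Bool → ℕ) (x : List Bool) : ℕ :=
  if h : ∃ y, M.FirstQuery O i x y then N h.choose else 0

theorem FirstQuery.queryRank_eq {O : Fin 2 → Language Bool} {i : Fin 2} {x y : List Bool}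
    (h : M.FirstQuery O i x y) (N : List Bool → ℕ) : M.queryRank O i N x = N y := by
  have h' : ∃ y, M.FirstQuery O i x y := ⟨y, h⟩
  rw [queryRank, dif_pos h', h'.choose_spec.unique h]

theorem lt_queryRank_iff {O : Fin 2 → Language Bool} {i : Fin 2} {N : List Bool → ℕ} {x : List Bool}
    {c : ℕ} : c < M.queryRank O i N x ↔ ∃ y, M.FirstQuery O i x y ∧ c < N y := by
  constructor
  · intro h
    by_cases h' : ∃ y, M.FirstQuery O i x y
    · obtain ⟨y, hy⟩ := h'
      exact ⟨y, hy, by rwa [hy.queryRank_eq] at h⟩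
    · rw [queryRank, dif_neg h'] at h
      omega
  · rintro ⟨y, hy, h⟩
    rwa [hy.queryRank_eq]

/-- The oracles that give the answers `a` and `b` to all questions. -/
def answers (a b : Bool) : Fin 2 → Language Bool :=
  ![{_y | a = true}, {_y | b = true}]

theorem mem_answers (a b : Bool) (i : Fin 2) (y : List Bool) :
    y ∈ answers a b i ↔ ![a, b] i = true := by
  fin_cases i <;> exact Iff.rfl

theorem isP_accepts (hdet : M.Deterministic) (hpoly : M.PolyTime) (a b : Bool) :
    IsP fun x => M.Accepts (answers a b) x := by
  obtain ⟨p, hp⟩ := hpoly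
  refine ⟨Option M.K, inferInstance, inferInstance, (M.sim fun i => some (![a, b] i)).bind
    fun r => .ret (r.elim id fun _ => false), some M.inp, p, (hdet.sim _).bind
    fun _ => Block.det_ret _, fun c x => ?_⟩
  obtain ⟨t, ht, v, hv⟩ := hp (answers a b) c x
  rcases M.sim_run (O' := Empty.elim) (ans := fun i => some (![a, b] i)) (fun i v h y => by
    rw [mem_answers, Option.some.inj h]) hv with ⟨d, hd, _⟩ | ⟨_, _, _, _, _, _, _, hn, _⟩
  · refine ⟨v, _, (Block.Runs.bind (C := fun r : Bool ⊕ M.K => .ret (r.elim id fun _ => false)) hd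
      (Block.runs_ret v _ 0)).mono (by omega), fun ⟨c', t', ht'⟩ => ?_, fun h => ⟨c, t, h ▸ hv⟩⟩
    rw [hdet.run_coins _ c' c] at ht'
    exact (run_eq_of_halt hv ht').2
  · cases hn

/-- Simulate the machine with only oracle `i` left unanswered. It stops at the first query to `i`
with the string at hand, whose rank is then tested; if it halts instead, the rank is `0` and the
test fails. -/
theorem npRank_queryRank (hdet : M.Deterministic) (hpoly : M.PolyTime) (a b : Bool) (i : Fin 2)
    {N : List Bool → ℕ} (hN : NPRank N) : NPRank (M.queryRank (answers a b) i N) := by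
  obtain ⟨p, hp⟩ := hpoly
  intro c
  refine IsNP.of_det (M.sim fun i' => if i' = i then none else some (![a, b] i')) (some M.inp)
    (Sum.elim (fun _ => none) some) (Sum.elim (fun _ _ => False) fun _ y => c < N y) ?_ p ?_
  · rintro (v | k)
    · exact .const _
    · exact hN c
  · intro coins x
    obtain ⟨t, ht, v, hv⟩ := hp (answers a b) coins x
    rw [lt_queryRank_iff]
    rcases M.sim_run (O' := Empty.elim) (ans := fun i' => if i' = i then none else some (![a, b] i'))
      (fun i' v h y => by
        split_ifs at h
        rw [mem_answers, Option.some.inj h]) hv with ⟨d, hd, hs⟩ | ⟨t', d, i', k, n, hd, hi, hn, hs⟩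
    · refine ⟨_, _, hd.mono ht, ⟨?_, False.elim⟩⟩
      rintro ⟨_, ⟨s, k, n, hi, _⟩, _⟩
      rw [hdet.run_coins _ _ coins] at hi
      exact hs s i k n hi (if_pos rfl)
    · obtain rfl : i' = i := by
        by_contra hne
        simp [hne] at hn
      have hq : M.FirstQuery (answers a b) i' x ((M.run (answers a b) coins x t').stk k) := by
        refine ⟨t', k, n, ?_, ?_, fun s hlt k n => ?_⟩
        · rwa [hdet.run_coins _ _ coins]
        · rw [hdet.run_coins _ _ coins]
        · rw [hdet.run_coins _ _ coins]
          exact fun h => hs s hlt i' k n h (if_pos rfl)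
      refine ⟨_, _, hd.mono ht, ⟨?_, fun h => ⟨_, hq, h⟩⟩⟩
      rintro ⟨y, hy, hc⟩
      rw [hy.unique hq] at hc
      exact hc

/-- Two queries put `[i, i']` as a sublist into `asked`, hence into `[0, 1]`, and the lengths agree.
-/
theorem query_order (h : ∀ O c x t, (M.run O c x t).asked.Sublist [0, 1])
    {O : Fin 2 → Language Bool} {c : ℕ → Bool} {x : List Bool} {s t : ℕ} (hst : s < t) {i i' : Fin 2}
    {k k' : M.K} {n n' : Bool → M.Q} (hs : M.instr (M.run O c x s).state = .query i k n)
    (ht : M.instr (M.run O c x t).state = .query i' k' n') : i = 0 ∧ i' = 1 := by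
  have h₁ := asked_prefix (M := M) O c x (Nat.succ_le_of_lt hst)
  have h₂ := h O c x (t + 1)
  rw [asked_query ht] at h₂
  rw [Nat.succ_eq_add_one, asked_query hs] at h₁
  have h₃ : [i, i'].Sublist [0, 1] := by
    refine List.Sublist.trans ?_ h₂
    exact List.Sublist.append ((List.sublist_append_right _ _).trans h₁.sublist)
      (List.Sublist.refl [i'])
  have h₄ := h₃.eq_of_length rfl
  simpa using h₄

/-- The two oracles can be replaced by the answers they give. -/
theorem accepts_iff_answers (hdet : M.Deterministic)
    (hord : ∀ O c x t, (M.run O c x t).asked.Sublist [0, 1]) {A B : Language Bool}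
    {NA NB : List Bool → ℕ} (hA : ∀ y, y ∈ A ↔ Odd (NA y)) (hB : ∀ y, y ∈ B ↔ Odd (NB y))
    {x : List Bool} {a b : Bool} (ha : a = decide (Odd (M.queryRank (answers false false) 0 NA x)))
    (hb : b = decide (Odd (M.queryRank (answers a false) 1 NB x))) :
    M.Accepts ![A, B] x ↔ M.Accepts (answers a b) x := by
  -- Nothing is asked before oracle `0`, so up to this query the run does not depend on the oracles.
  have h0 : ∀ s k n, M.instr (M.run ![A, B] (fun _ => false) x s).state = .query 0 k n →
      ((M.run ![A, B] (fun _ => false) x s).stk k ∈ A ↔ a = true) := by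
    intro s k n hs
    have hbefore : ∀ s' < s, ∀ i k n,
        M.instr (M.run ![A, B] (fun _ => false) x s').state ≠ .query i k n := by
      intro s' hs' i k' n' hq
      exact absurd (query_order hord hs' hq hs).2 (by decide)
    have hrun : ∀ s' ≤ s, M.run (answers false false) (fun _ => false) x s' =
        M.run ![A, B] (fun _ => false) x s' := fun s' hs' =>
      run_congr fun r hr i k n hq => absurd hq (hbefore r (by omega) i k n)
    have hq : M.FirstQuery (answers false false) 0 x
        ((M.run ![A, B] (fun _ => false) x s).stk k) := by
      refine ⟨s, k, n, ?_, ?_, fun s' hs' k n => ?_⟩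
      · rwa [hrun s le_rfl]
      · rw [hrun s le_rfl]
      · rw [hrun s' hs'.le]
        exact hbefore s' hs' 0 k n
    rw [ha, hq.queryRank_eq, hA, decide_eq_true_iff]
  -- Before oracle `1` only oracle `0` can have been asked, and by `h0` it answered `a`; so the run
  -- so far is that with `answers a false`.
  have h1 : ∀ s k n, M.instr (M.run ![A, B] (fun _ => false) x s).state = .query 1 k n →
      ((M.run ![A, B] (fun _ => false) x s).stk k ∈ B ↔ b = true) := by
    intro s k n hs
    have hbefore : ∀ s' < s, ∀ k n,
        M.instr (M.run ![A, B] (fun _ => false) x s').state ≠ .query 1 k n := by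
      intro s' hs' k' n' hq
      exact absurd (query_order hord hs' hq hs).1 (by decide)
    have hrun : ∀ s' ≤ s, M.run (answers a false) (fun _ => false) x s' =
        M.run ![A, B] (fun _ => false) x s' := by
      refine fun s' hs' => run_congr fun r hr i k n hq => ?_
      obtain rfl | rfl : i = 0 ∨ i = 1 := by omega
      · rw [mem_answers]
        exact h0 r k n hq
      · exact absurd hq (hbefore r (by omega) k n)
    have hq : M.FirstQuery (answers a false) 1 x
        ((M.run ![A, B] (fun _ => false) x s).stk k) := by
      refine ⟨s, k, n, ?_, ?_, fun s' hs' k n => ?_⟩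
      · rwa [hrun s le_rfl]
      · rw [hrun s le_rfl]
      · rw [hrun s' hs'.le]
        exact hbefore s' hs' k n
    rw [hb, hq.queryRank_eq, hB, decide_eq_true_iff]
  have hrun : ∀ t, M.run (answers a b) (fun _ => false) x t =
      M.run ![A, B] (fun _ => false) x t := by
    refine fun t => run_congr fun r hr i k n hq => ?_
    rw [mem_answers]
    obtain rfl | rfl : i = 0 ∨ i = 1 := by omega
    · exact h0 r k n hq
    · exact h1 r k n hq
  constructor
  · rintro ⟨c, t, ht⟩
    rw [hdet.run_coins _ _ fun _ => false] at ht
    exact ⟨fun _ => false, t, by rwa [hrun t]⟩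
  · rintro ⟨c, t, ht⟩
    rw [hdet.run_coins _ _ fun _ => false] at ht
    exact ⟨fun _ => false, t, by rwa [← hrun t]⟩

end twoQueries

end Machine

/-! ### Counting the mind changes of two queries -/

/-- The outcome of two queries in terms of the ranks of the strings that may be asked about. -/
def outcome (j k : ℕ) (γ : Bool → Bool → Bool) (s : Fin (j + 1) × Fin (k + 1) × Fin (k + 1)) :
    Prop :=
  γ (decide (Odd s.1.val))
    (decide (Odd (if Odd s.1.val then s.2.2.val else s.2.1.val))) = true

theorem alternates_outcome_le {j k : ℕ} {γ : Bool → Bool → Bool} {c : ℕ}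
    {s : Fin (j + 1) × Fin (k + 1) × Fin (k + 1)} (h : Alternates (outcome j k γ) c s) :
    c ≤ s.1.val + s.2.1.val + s.2.2.val := by
  refine h.le (ρ := fun s => s.1.val + s.2.1.val + s.2.2.val) fun s t hst hne => ?_
  obtain ⟨a, b, b'⟩ := s
  obtain ⟨a', d, d'⟩ := t
  obtain ⟨h₁, h₂, h₃⟩ := hst
  simp only [Fin.le_def] at h₁ h₂ h₃
  by_contra hlt
  simp only at hlt
  obtain rfl : a = a' := Fin.ext (by omega)
  obtain rfl : b = d := Fin.ext (by omega)
  obtain rfl : b' = d' := Fin.ext (by omega)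
  exact hne Iff.rfl

/-- If the second answer is irrelevant after a first no, then the middle rank never influences the
outcome. -/
theorem alternates_outcome_le_of_const {j k : ℕ} {γ : Bool → Bool → Bool} {c : ℕ}
    {s : Fin (j + 1) × Fin (k + 1) × Fin (k + 1)} (h : Alternates (outcome j k γ) c s)
    (hγ : ∀ b, γ false b = γ false false) : c ≤ s.1.val + s.2.2.val := by
  refine h.le (ρ := fun s => s.1.val + s.2.2.val) fun s t hst hne => ?_
  obtain ⟨a, b, b'⟩ := s
  obtain ⟨a', d, d'⟩ := t
  obtain ⟨h₁, h₂, h₃⟩ := hst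
  simp only [Fin.le_def] at h₁ h₂ h₃
  by_contra hlt
  simp only at hlt
  obtain rfl : a = a' := Fin.ext (by omega)
  obtain rfl : b' = d' := Fin.ext (by omega)
  refine hne ?_
  by_cases ha : Odd a.val
  · simp [outcome, ha]
  · simp only [outcome, ha, decide_false]
    rw [hγ, hγ (decide _)]

theorem alternates_outcome_le_of_even_odd {j k : ℕ} (hj : Even j) (hk : Odd k)
    {γ : Bool → Bool → Bool} {c : ℕ} {s : Fin (j + 1) × Fin (k + 1) × Fin (k + 1)}
    (h : Alternates (outcome j k γ) c s) : c ≤ j + 2 * k - 1 := by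
  have hle := alternates_outcome_le h
  have hk0 : 0 < k := hk.pos
  by_contra hc
  obtain ⟨a, b, b'⟩ := s
  simp only at hle
  -- More than `j + 2k - 1` changes exhaust all three ranks, so the chain ends at the top.
  have ha : a.val = j := by omega
  have hb : b.val = k := by omega
  have heq := h.iff_even
  have hbot : outcome j k γ ⊥ ↔ γ false false = true := by
    change γ (decide (Odd 0)) (decide (Odd (if Odd 0 then 0 else 0))) = true ↔ _
    simp
  have htop : outcome j k γ (a, b, b') ↔ γ false true = true := by
    simp [outcome, ha, hb, hk, Nat.not_odd_iff_even.2 hj]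
  obtain rfl : c = j + 2 * k := by omega
  have heven : Even (j + 2 * k) := hj.add (even_two_mul k)
  simp only [htop, hbot, heven, iff_true] at heq
  have := alternates_outcome_le_of_const h fun b => by
    cases b
    · rfl
    · exact Bool.eq_iff_iff.2 heq
  simp only at this
  omega

theorem MindChanges.of_POneOne {j k : ℕ} (hj : 1 ≤ j) (hk : 1 ≤ k) {L : Language Bool}
    (h : L ∈ POneOne (BH j) (BH k)) {m : ℕ}
    (hm : ∀ γ c s, Alternates (outcome j k γ) c s → c ≤ m) : MindChanges m (· ∈ L) := by
  classical
  obtain ⟨A, hA, B, hB, M, hdet, hpoly, hord, hL⟩ := h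
  obtain ⟨NA, hNA, hAle, hA⟩ := (mem_BH_iff hj).1 hA
  obtain ⟨NB, hNB, hBle, hB⟩ := (mem_BH_iff hk).1 hB
  have hle : ∀ {O i N n}, (∀ x, N x ≤ n) → ∀ x, M.queryRank O i N x < n + 1 := by
    intro O i N n hN x
    by_contra hlt
    obtain ⟨y, _, hy⟩ := Machine.lt_queryRank_iff.1 (show n < M.queryRank O i N x by omega)
    exact absurd (hN y) (by omega)
  let R₀ := M.queryRank (Machine.answers false false) 0 NA
  let R₁ := fun a => M.queryRank (Machine.answers a false) 1 NB
  -- Here `γ` is the table of verdicts for the four possible pairs of answers.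
  have key := MindChanges.of_alternation (X := Fin (j + 1) × Fin (k + 1) × Fin (k + 1))
    (Γ := Bool → Bool → Bool) (F := outcome j k) (m := m)
    (σ := fun x => (⟨R₀ x, hle hAle x⟩, ⟨R₁ false x, hle hBle x⟩, ⟨R₁ true x, hle hBle x⟩))
    (g := fun x a b => decide (M.Accepts (Machine.answers a b) x)) ?_ ?_ ?_ hm
  · obtain ⟨F, hF, N, hN, hNle, hiff⟩ := key
    refine ⟨F, hF, N, hN, hNle, fun x => ?_⟩
    refine Iff.trans ?_ (hiff x)
    change x ∈ L ↔ _
    rw [hL, Machine.accepts_iff_answers hdet hord hA hB rfl rfl]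
    simp only [outcome, decide_eq_true_iff]
    by_cases ha : Odd (R₀ x)
    · simp [R₀, R₁, ha]
    · simp [R₀, R₁, ha]
  · rintro ⟨a, b, b'⟩
    exact (((Machine.npRank_queryRank hdet hpoly _ _ _ hNA).isNP_le a).and
      (((Machine.npRank_queryRank hdet hpoly _ _ _ hNB).isNP_le b).and
        ((Machine.npRank_queryRank hdet hpoly _ _ _ hNB).isNP_le b'))).congr fun x => Iff.rfl
  · intro γ
    refine (IsNP.forall fun a => IsNP.forall fun b =>
      (Machine.isP_accepts hdet hpoly a b).isNP_eq (γ a b = true)).congr fun x => ?_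
    rw [funext_iff]
    refine forall_congr' fun a => ?_
    rw [funext_iff]
    refine forall_congr' fun b => ?_
    rw [Bool.eq_iff_iff, decide_eq_true_iff]
  · refine (Machine.isP_accepts hdet hpoly false false).congr fun x => ?_
    change decide (M.Accepts (Machine.answers (decide (Odd 0))
      (decide (Odd (if Odd 0 then 0 else 0)))) x) = true ↔ _
    simp

/-! ### Few mind changes are decided with two queries -/

/-- Ask about the input and then about the input tagged with the first answer. -/
def Block.twoQueries {K : Type} (B : Block Empty K Bool) (inp : K)
    (v : Bool → Bool → Bool → Bool) : Block (Fin 2) (K ⊕ Fin 4) Bool :=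
  (B.dup inp).bind fun f => (query 0 (.inr 2)).bind fun a =>
    (push (.inr 2) a).bind fun _ => (query 1 (.inr 2)).bind fun b => ret (v f a b)

open scoped Classical in
theorem Block.Runs.twoQueries {K : Type} [DecidableEq K] {B : Block Empty K Bool} {inp : K}
    (v : Bool → Bool → Bool → Bool) (O : Fin 2 → Language Bool) {coins : ℕ → Bool} {x : List Bool}
    {T : ℕ} {f : Bool} {m : Mem Empty K} (h : B.Runs Empty.elim (Mem.init inp coins x) T f m) :
    ∃ m', m'.asked = [0, 1] ∧ (B.twoQueries inp v).Runs O (Mem.init (.inr 0) coins x)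
      (5 * x.length + T + 5)
      (v f (decide (x ∈ O 0)) (decide (decide (x ∈ O 0) :: x ∈ O 1))) m' := by
  have h₁ := h.dup (O := O)
  have h₂ := runs_query (O := O) 0 (.inr 2) (Mem.mk (Sum.elim m.stk fun r : Fin 4 =>
    if r = 2 then x else []) m.coins [])
  have h₃ := runs_push (O := O) (.inr 2) (decide (x ∈ O 0)) (Mem.mk (Sum.elim m.stk fun r : Fin 4 =>
    if r = 2 then x else []) m.coins [0])
  have h₄ := runs_query (O := O) 1 (.inr 2) (Mem.mk (update (Sum.elim m.stk fun r : Fin 4 =>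
    if r = 2 then x else []) (.inr 2) (decide (x ∈ O 0) :: x)) m.coins [0])
  simp only [update_self, Sum.elim_inr, if_true] at h₂ h₃ h₄
  have h₅ := h₄.bind (C := fun b => ret (v f (decide (x ∈ O 0)) b)) (runs_ret _ _ 0)
  have h₆ := h₃.bind (C := fun _ => (query 1 (.inr 2)).bind fun b =>
    ret (v f (decide (x ∈ O 0)) b)) h₅
  have h₇ := h₂.bind (C := fun a => (push (.inr 2) a).bind fun _ => (query 1 (.inr 2)).bind fun b =>
    ret (v f a b)) h₆
  have h₈ := h₁.bind (C := fun f => (query 0 (.inr 2)).bind fun a => (push (.inr 2) a).bind fun _ =>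
    (query 1 (.inr 2)).bind fun b => ret (v f a b)) h₇
  exact ⟨_, rfl, Runs.mono (B := B.twoQueries inp v) h₈ (by omega)⟩

theorem mem_POneOne_of {j k : ℕ} (hj : 1 ≤ j) (hk : 1 ≤ k) {L : Language Bool}
    {F : List Bool → Prop} (hF : IsP F) {NA : List Bool → ℕ} (hNA : NPRank NA)
    (hAle : ∀ x, NA x ≤ j) {NB : Bool → List Bool → ℕ} (hNB : ∀ a, NPRank (NB a))
    (hBle : ∀ a x, NB a x ≤ k) (v : Bool → Bool → Bool → Bool)
    (hL : ∀ x f a b, (f = true ↔ F x) → (a = true ↔ Odd (NA x)) → (b = true ↔ Odd (NB a x)) →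
      (x ∈ L ↔ v f a b = true)) :
    L ∈ POneOne (BH j) (BH k) := by
  classical
  -- The second query carries the first answer as its leading bit, so a single language serves both
  -- ranks `NB false` and `NB true`. The empty string is never asked.
  let NB' : List Bool → ℕ := fun w => w.casesOn 0 NB
  have hNB' : NPRank NB' := by
    intro c
    refine (IsNP.exists fun b => (hNB b c).cons b).congr fun w => ?_
    rcases w with _ | ⟨b, x⟩ <;> simp [NB']
  have hBle' : ∀ w, NB' w ≤ k := by
    intro w
    rcases w with _ | ⟨b, x⟩
    · exact Nat.zero_le _
    · exact hBle b x
  obtain ⟨K, _, _, B, inp, p, hdet, hB⟩ := hF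
  have halt : ∀ (O : Fin 2 → Language Bool) coins x, ∃ f, (f = true ↔ F x) ∧
      ∃ t ≤ (p + 5 * Polynomial.X + 5).eval x.length,
      let r := ((B.twoQueries inp v).toMachine (Sum.inr 0) (Sum.inr 0)).run O coins x t
      r.asked = [0, 1] ∧ ((B.twoQueries inp v).toMachine (Sum.inr 0) (Sum.inr 0)).instr r.state =
        .halt (v f (decide (x ∈ O 0)) (decide (decide (x ∈ O 0) :: x ∈ O 1))) := by
    intro O coins x
    obtain ⟨f, m, hr, hf⟩ := hB coins x
    obtain ⟨m', hasked, hr'⟩ := hr.twoQueries v O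
    obtain ⟨t, ht, h⟩ := hr'.run (inp := Sum.inr 0) (out := Sum.inr 0)
    refine ⟨f, hf.symm, t, ht.trans (by simp; omega), ?_⟩
    simp only [h]
    exact ⟨hasked, rfl⟩
  refine ⟨{x | Odd (NA x)}, (mem_BH_iff hj).2 ⟨NA, hNA, hAle, fun _ => Iff.rfl⟩,
    {w | Odd (NB' w)}, (mem_BH_iff hk).2 ⟨NB', hNB', hBle', fun _ => Iff.rfl⟩,
    (B.twoQueries inp v).toMachine (Sum.inr 0) (Sum.inr 0), ?_,
    ⟨p + 5 * Polynomial.X + 5, fun O coins x => ?_⟩,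
    fun O coins x t => ?_, fun x => ?_⟩
  · exact Block.Det.toMachine ((hdet.dup _).bind fun _ => (Block.det_query _ _).bind fun _ =>
      (Block.det_push _ _).bind fun _ => (Block.det_query _ _).bind fun _ => Block.det_ret _) _ _
  · obtain ⟨f, _, t, ht, _, h⟩ := halt O coins x
    exact ⟨t, ht, _, h⟩
  · obtain ⟨f, _, t', _, ha, h⟩ := halt O coins x
    rw [← ha]
    rcases le_total t t' with hle | hle
    · exact (Machine.asked_prefix _ _ _ hle).sublist
    · rw [Machine.run_of_halt h hle]
  · set O : Fin 2 → Language Bool := ![{x | Odd (NA x)}, {w | Odd (NB' w)}] with hO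
    have hv := fun f (hf : f = true ↔ F x) =>
      hL x f (decide (x ∈ O 0)) (decide (decide (x ∈ O 0) :: x ∈ O 1)) hf
        (decide_eq_true_iff.trans Iff.rfl) (decide_eq_true_iff.trans Iff.rfl)
    constructor
    · intro hx
      obtain ⟨f, hf, t, _, _, h⟩ := halt O (fun _ => false) x
      exact ⟨_, t, h.trans (by rw [(hv f hf).1 hx])⟩
    · rintro ⟨coins, t, ht⟩
      obtain ⟨f, hf, t', _, _, h⟩ := halt O coins x
      exact (hv f hf).2 (Machine.run_eq_of_halt ht h).2.symm

theorem MindChanges.mem_POneOne_of_odd {i j k : ℕ} (hi : Odd i) (hij : i ≤ j) (hk : 1 ≤ k)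
    {L : Language Bool} (h : MindChanges (i + 2 * k) (· ∈ L)) : L ∈ POneOne (BH j) (BH k) := by
  classical
  obtain ⟨F, hF, N, hN, hle, hL⟩ := h
  refine mem_POneOne_of (by have := hi.pos; omega) hk hF (NA := fun x => min (N x - k) i)
    -- The counter passes through three phases of lengths `k`, `i`, `k`. While the middle one runs,
    -- the two second ranks stand still at `k` and `0`, and the parity of the first rank alternates
    -- between them. As `i` is odd, it finally settles on the answer yes, where the last phase is
    -- read off.
    (hN.comp (φ := fun n => min (n - k) i) fun a b h => by dsimp only; omega) (fun x => by omega)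
    (NB := fun a x => if a then min (N x - k - i) k else min (N x) k) (fun a => ?_) (fun a x => ?_)
    (fun f a b => f == if a then b == decide (Even k) else !b) fun x f a b hf ha hb => ?_
  · exact hN.comp (φ := fun n => if a then min (n - k - i) k else min n k) fun n n' h => by
      dsimp only
      split_ifs <;> omega
  · split_ifs <;> omega
  · have := hle x
    rw [Nat.odd_iff] at ha hb hi
    have key : Even (N x) ↔ (if a then b == decide (Even k) else !b) = true := by
      cases a
      · have ha : ¬ min (N x - k) i % 2 = 1 := fun h => Bool.false_ne_true (ha.2 h)
        have hb : b = true ↔ min (N x) k % 2 = 1 := hb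
        change _ ↔ (!b) = true
        rw [Bool.not_eq_true', ← Bool.not_eq_true, hb, Nat.even_iff]
        omega
      · have ha : min (N x - k) i % 2 = 1 := ha.1 rfl
        have hb : b = true ↔ min (N x - k - i) k % 2 = 1 := hb
        change _ ↔ (b == decide (Even k)) = true
        rw [beq_iff_eq, Bool.eq_iff_iff, hb, decide_eq_true_iff, Nat.even_iff, Nat.even_iff]
        omega
    refine (hL x).trans ?_
    rw [← hf, key, beq_iff_eq]
    exact Bool.eq_iff_iff.symm

theorem MindChanges.mem_POneOne_of_even {j k : ℕ} (hj : 1 ≤ j) (hj' : Even j) (hk : 1 ≤ k)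
    (hk' : Even k) {L : Language Bool} (h : MindChanges (j + 2 * k) (· ∈ L)) :
    L ∈ POneOne (BH j) (BH k) := by
  classical
  obtain ⟨F, hF, N, hN, hle, hL⟩ := h
  refine mem_POneOne_of hj hk hF
    -- The second summand is `1` only when `N x = j + 2k`. It lifts the first rank from `j - 1` to
    -- the even number `j`, so the machine returns to the rank `min (N x) k = k`, which is even like
    -- `N x`.
    (NA := fun x => min (N x - k) (j - 1) + (N x + 1 - (j + 2 * k)))
    (hN.comp (φ := fun n => min (n - k) (j - 1) + (n + 1 - (j + 2 * k)))
      fun a b h => by dsimp only; omega) (fun x => by have := hle x; omega)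
    (NB := fun a x => if a then min (N x - k - (j - 1)) k else min (N x) k) (fun a => ?_)
    (fun a x => ?_) (fun f a b => f == if a then b else !b) fun x f a b hf ha hb => ?_
  · exact hN.comp (φ := fun n => if a then min (n - k - (j - 1)) k else min n k) fun n n' h => by
      dsimp only
      split_ifs <;> omega
  · split_ifs <;> omega
  · have := hle x
    rw [Nat.odd_iff] at ha hb
    rw [Nat.even_iff] at hj' hk'
    have key : Even (N x) ↔ (if a then b else !b) = true := by
      cases a
      · have ha : ¬ (min (N x - k) (j - 1) + (N x + 1 - (j + 2 * k))) % 2 = 1 :=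
          fun h => Bool.false_ne_true (ha.2 h)
        have hb : b = true ↔ min (N x) k % 2 = 1 := hb
        change _ ↔ (!b) = true
        rw [Bool.not_eq_true', ← Bool.not_eq_true, hb, Nat.even_iff]
        omega
      · have ha : (min (N x - k) (j - 1) + (N x + 1 - (j + 2 * k))) % 2 = 1 := ha.1 rfl
        have hb : b = true ↔ min (N x - k - (j - 1)) k % 2 = 1 := hb
        change _ ↔ b = true
        rw [hb, Nat.even_iff]
        omega
    refine (hL x).trans ?_
    rw [← hf, key, beq_iff_eq]
    exact Bool.eq_iff_iff.symm

/-! ### Few mind changes are decided by a truth-table reduction -/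

/-- The string `x` tagged with the number `c`. -/
def tag (c : ℕ) (x : List Bool) : List Bool :=
  List.replicate c true ++ false :: x

theorem tag_inj {c c' : ℕ} {x x' : List Bool} (h : tag c x = tag c' x') : c = c' ∧ x = x' := by
  induction c generalizing c' with
  | zero =>
    cases c' with
    | zero => simpa [tag] using h
    | succ c' => simp [tag, List.replicate_succ] at h
  | succ c ih =>
    cases c' with
    | zero => simp [tag, List.replicate_succ] at h
    | succ c' =>
      have := ih (c' := c') (by simpa [tag, List.replicate_succ] using h)
      exact ⟨congrArg _ this.1, this.2⟩

theorem IsNP.tag {P : List Bool → Prop} (h : IsNP P) (c : ℕ) :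
    IsNP fun w => ∃ x, w = tag c x ∧ P x := by
  induction c with
  | zero => exact (h.cons false).congr fun w => Iff.rfl
  | succ c ih =>
    refine (ih.cons true).congr fun w => ⟨?_, ?_⟩
    · rintro ⟨x, rfl, hx⟩
      exact ⟨_, rfl, x, rfl, hx⟩
    · rintro ⟨_, rfl, x, rfl, hx⟩
      exact ⟨x, rfl, hx⟩

namespace Block

variable {ι K : Type}

/-- Prepend the pair component `tag c x` to the code on stack `inr 3`, where `x` is the string on
stack `inr 2`. -/
def emit (c : ℕ) : Block ι (K ⊕ Fin 4) Unit :=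
  (push (.inr 3) false).bind fun _ => (drain (.inr 2) fun b => [(.inr 1, b)]).bind fun _ =>
    (drain (.inr 1) fun b => [(.inr 2, b), (.inr 3, b), (.inr 3, true)]).bind fun _ =>
      pushL (((tag c []).flatMap fun b => [true, b]).reverse.map fun b => (.inr 3, b))

/-- Prepend the pair components `tag c x` for several numbers `c`. -/
def emitAll : List ℕ → Block ι (K ⊕ Fin 4) Unit
  | [] => ret ()
  | c :: l => (emitAll l).bind fun _ => emit c

theorem det_emit (c : ℕ) : (emit c : Block ι (K ⊕ Fin 4) Unit).Det :=
  (det_push _ _).bind fun _ => (det_drain _ _).bind fun _ => (det_drain _ _).bind fun _ =>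
    det_pushL _

theorem det_emitAll (l : List ℕ) : (emitAll l : Block ι (K ⊕ Fin 4) Unit).Det := by
  induction l with
  | nil => exact det_ret _
  | cons c l ih => exact ih.bind fun _ => det_emit c

variable [DecidableEq K] {O : ι → Language Bool}

theorem bitsFor_map (k k' : K) (l : List Bool) :
    bitsFor k' (l.map fun b => (k, b)) = if k = k' then l else [] := by
  by_cases h : k = k'
  · induction l <;> simp_all [bitsFor]
  · rw [if_neg h]
    refine bitsFor_eq_nil fun p hp => ?_
    obtain ⟨b, _, rfl⟩ := List.mem_map.1 hp
    exact h

theorem flatMap_pair_reverse (x : List Bool) :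
    (x.reverse.flatMap fun b => [b, true]).reverse = x.flatMap fun b => [true, b] := by
  induction x with
  | nil => rfl
  | cons b x ih => simp [ih]

set_option maxHeartbeats 1000000 in
theorem runs_emit (c : ℕ) (x w : List Bool) (s : K → List Bool) (coins : ℕ → Bool) (a : List ι) :
    (emit c).Runs O ⟨Sum.elim s ![[], [], x, w], coins, a⟩ (6 * x.length + 2 * c + 5) ()
      ⟨Sum.elim s ![[], [], x, pair (tag c x) w], coins, a⟩ := by
  have h₁ : (push (.inr 3) false).Runs O ⟨Sum.elim s ![[], [], x, w], coins, a⟩ 1 ()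
      ⟨Sum.elim s ![[], [], x, false :: w], coins, a⟩ := by
    refine (runs_push _ _ _).of_eq le_rfl ?_ rfl rfl
    rintro (k | r)
    · simp
    · fin_cases r <;> simp
  have h₂ : (drain (.inr 2) fun b => [(.inr 1, b)]).Runs O
      ⟨Sum.elim s ![[], [], x, false :: w], coins, a⟩ (x.length * 2 + 1) ()
      ⟨Sum.elim s ![[], x.reverse, [], false :: w], coins, a⟩ := by
    refine (runs_drain (by simp) (c := 1) (by simp) x _ (by simp)).of_eq le_rfl ?_ rfl rfl
    rintro (k | r)
    · simp [bitsFor]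
    · fin_cases r <;> simp [bitsFor]
  have h₃ : (drain (.inr 1) fun b => [(.inr 2, b), (.inr 3, b), (.inr 3, true)]).Runs O
      ⟨Sum.elim s ![[], x.reverse, [], false :: w], coins, a⟩ (x.length * 4 + 1) ()
      ⟨Sum.elim s ![[], [], x, (x.flatMap fun b => [true, b]) ++ false :: w], coins, a⟩ := by
    refine (runs_drain (by simp) (c := 3) (by simp) x.reverse _ (by simp)).of_eq (by simp) ?_ rfl rfl
    rintro (k | r)
    · simp [bitsFor]
    · fin_cases r <;> simp [bitsFor, flatMap_pair_reverse]
  have h₄ : (pushL (((tag c []).flatMap fun b => [true, b]).reverse.map fun b => (.inr 3, b))).Runs O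
      ⟨Sum.elim s ![[], [], x, (x.flatMap fun b => [true, b]) ++ false :: w], coins, a⟩
      -- The `c + 1` bits of `tag c []`, each preceded by a `1`, complete the code of `tag c x`.
      (2 * c + 2) () ⟨Sum.elim s ![[], [], x, pair (tag c x) w], coins, a⟩ := by
    refine (runs_pushL _ _).of_eq ?_ ?_ rfl rfl
    · simp [tag]
      omega
    · rintro (k | r)
      · simp only [pushAll_apply, bitsFor_map]
        simp
      · simp only [pushAll_apply, bitsFor_map]
        fin_cases r <;> simp [pair, tag]
  have h₅ := h₃.bind (C := fun _ => pushL (((tag c []).flatMap fun b => [true, b]).reverse.map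
    fun b => ((.inr 3 : K ⊕ Fin 4), b))) h₄
  have h₆ := h₂.bind (C := fun _ =>
    (drain (.inr 1) fun b => [(.inr 2, b), (.inr 3, b), (.inr 3, true)]).bind fun _ =>
      pushL (((tag c []).flatMap fun b => [true, b]).reverse.map fun b => (.inr 3, b))) h₅
  have h₇ := h₁.bind (C := fun _ => (drain (.inr 2) fun b => [(.inr 1, b)]).bind fun _ =>
    (drain (.inr 1) fun b => [(.inr 2, b), (.inr 3, b), (.inr 3, true)]).bind fun _ =>
      pushL (((tag c []).flatMap fun b => [true, b]).reverse.map fun b => (.inr 3, b))) h₆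
  exact Runs.mono (B := emit c) h₇ (by omega)

theorem runs_emitAll (l : List ℕ) (x w : List Bool) (s : K → List Bool) (coins : ℕ → Bool)
    (a : List ι) :
    (emitAll l).Runs O ⟨Sum.elim s ![[], [], x, w], coins, a⟩
      (l.length * (6 * x.length + 5) + 2 * l.sum) ()
      ⟨Sum.elim s ![[], [], x, (l.map fun c => tag c x).foldr pair w], coins, a⟩ := by
  induction l with
  | nil => exact runs_ret _ _ _
  | cons c l ih =>
    refine (ih.bind (C := fun _ => emit c) (runs_emit c x _ s coins a)).mono ?_
    simp only [List.length_cons, List.sum_cons, Nat.add_mul]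
    omega

end Block

theorem MindChanges.mem_RTT {m : ℕ} {L : Language Bool} (h : MindChanges m (· ∈ L)) :
    L ∈ RTT m NP := by
  classical
  obtain ⟨F, hF, N, hN, hle, hL⟩ := h
  -- The queries are the strings `x` tagged with `c < m`, and the answer is yes iff `c < N x`. Since
  -- `N x ≤ m`, the number of yes answers is `N x`.
  let α : Bool → (Fin m → Bool) → Bool := fun f v =>
    f == decide (Even (Finset.univ.filter fun i => v i = true).card)
  obtain ⟨C, hC⟩ : ∃ C : Language Bool, ∀ w, w ∈ C ↔ ∃ c : Fin m, ∃ x, w = tag c x ∧ c < N x :=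
    ⟨{w | ∃ c : Fin m, ∃ x, w = tag c x ∧ c < N x}, fun _ => Iff.rfl⟩
  refine ⟨C, (IsNP.exists fun c : Fin m => (hN c).tag c).congr (P' := (· ∈ C)) hC,
    fun x i => tag i x, fun x => α (decide (F x)), ?_, fun x => ?_⟩
  · obtain ⟨K, _, _, B, inp, p, hdet, hB⟩ := hF
    let tt : Bool → List ((K ⊕ Fin 4) × Bool) := fun f =>
      (truthTable (α f)).reverse.map fun b => (.inr 3, b)
    let C : Bool → Block Empty (K ⊕ Fin 4) Bool := fun f => (Block.pushL (tt f)).bind fun _ =>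
      (Block.emitAll (List.range m)).bind fun _ => Block.ret true
    obtain ⟨S, hS⟩ : ∃ S, (List.range m).sum = S := ⟨_, rfl⟩
    let q : Polynomial ℕ := p + 5 * Polynomial.X + (m : Polynomial ℕ) * (6 * Polynomial.X + 5) +
      ((2 + 2 ^ m + 2 * S : ℕ) : Polynomial ℕ)
    have run : ∀ coins x, ∃ m', ((B.dup inp).bind C).Runs Empty.elim
        (Mem.init (Sum.inr 0) coins x) (q.eval x.length) true m' ∧
        m'.stk (.inr 3) = encodeTT (fun i : Fin m => tag i x) (α (decide (F x))) := by
      intro coins x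
      obtain ⟨f, c, hr, hf⟩ := hB coins x
      obtain rfl : decide (F x) = f := by cases f <;> simp_all
      have h₁ : (Block.pushL (tt (decide (F x)))).Runs Empty.elim
          ⟨Sum.elim c.stk fun r => if r = 2 then x else [], c.coins, []⟩ (2 ^ m) ()
          ⟨Sum.elim c.stk ![[], [], x, truthTable (α (decide (F x)))], c.coins, []⟩ := by
        refine (Block.runs_pushL _ _).of_eq (by simp [tt, truthTable]) ?_ rfl rfl
        rintro (k | r)
        · simp only [tt, pushAll_apply, Block.bitsFor_map]
          simp
        · simp only [tt, pushAll_apply, Block.bitsFor_map]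
          fin_cases r <;> simp
      have h₂ := (Block.runs_emitAll (O := Empty.elim) (List.range m) x
        (truthTable (α (decide (F x)))) c.stk c.coins []).bind
        (C := fun _ => (Block.ret true : Block Empty (K ⊕ Fin 4) Bool)) (Block.runs_ret _ _ 0)
      refine ⟨_, (hr.dup.bind (C := C) (h₁.bind (C := fun _ =>
        (Block.emitAll (List.range m)).bind fun _ => Block.ret true) h₂)).mono ?_, ?_⟩
      · simp [q, hS]
        omega
      · have : (List.range m).map (fun c => tag c x) = List.ofFn fun i : Fin m => tag i x := by
          apply List.ext_getElem <;> simp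
        change ((List.range m).map fun c => tag c x).foldr pair _ = _
        rw [this]
        rfl
    refine ⟨((B.dup inp).bind C).toMachine (Sum.inr 0) (Sum.inr 3), ?_, ⟨q, fun O coins x => ?_⟩,
      fun coins x => ?_⟩
    · exact Block.Det.toMachine ((hdet.dup _).bind fun _ => (Block.det_pushL _).bind fun _ =>
        (Block.det_emitAll _).bind fun _ => Block.det_ret _) _ _
    · obtain rfl : O = Empty.elim := Subsingleton.elim _ _
      obtain ⟨m', hr, _⟩ := run coins x
      obtain ⟨t, ht, h⟩ := hr.run (inp := Sum.inr 0) (out := Sum.inr 3)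
      exact ⟨t, ht, true, by rw [h]; rfl⟩
    · obtain ⟨m', hr, hout⟩ := run coins x
      obtain ⟨t, ht, h⟩ := hr.run (inp := Sum.inr 0) (out := Sum.inr 3)
      exact ⟨t, true, by rw [h]; rfl, by rw [h]; exact hout⟩
  · have hmem : ∀ i : Fin m, tag i x ∈ C ↔ (i : ℕ) < N x := by
      intro i
      rw [hC]
      constructor
      · rintro ⟨c, x', h, hc⟩
        obtain ⟨h₁, rfl⟩ := tag_inj h
        rwa [h₁]
      · exact fun h => ⟨i, x, rfl, h⟩
    have hcard : (Finset.univ.filter fun i : Fin m => (i : ℕ) < N x).card = N x := by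
      rw [Fin.card_filter_val_lt, min_eq_right (hle x)]
    refine (hL x).trans ?_
    simp [α, hmem, hcard]

end QueryOrder

/-! ### Assembling the inclusions -/

theorem theorem3p6 (j k : ℕ) (hj : 1 ≤ j) (hk : 1 ≤ k) :
    QueryOrder.POneOne (QueryOrder.BH j) (QueryOrder.BH k) =
      if Even j ∧ Odd k then QueryOrder.RTT (j + 2 * k - 1) QueryOrder.NP
      else QueryOrder.RTT (j + 2 * k) QueryOrder.NP := by
  split_ifs with h
  · obtain ⟨hj', hk'⟩ := h
    refine Set.Subset.antisymm (fun L hL => ?_) fun L hL => ?_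
    · exact (QueryOrder.MindChanges.of_POneOne hj hk hL fun γ c s hs =>
        QueryOrder.alternates_outcome_le_of_even_odd hj' hk' hs).mem_RTT
    · refine QueryOrder.MindChanges.mem_POneOne_of_odd (i := j - 1) ?_ (Nat.sub_le j 1) hk ?_
      · rw [Nat.odd_iff]
        rw [Nat.even_iff] at hj'
        omega
      · rw [show j - 1 + 2 * k = j + 2 * k - 1 by omega]
        exact QueryOrder.MindChanges.of_RTT hL
  · refine Set.Subset.antisymm (fun L hL => ?_) fun L hL => ?_
    · refine (QueryOrder.MindChanges.of_POneOne hj hk hL fun γ c s hs => ?_).mem_RTT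
      have := QueryOrder.alternates_outcome_le hs
      omega
    · rcases Nat.even_or_odd j with hj' | hj'
      · have hk' : Even k := by
          rw [← Nat.not_odd_iff_even]
          exact fun hk' => h ⟨hj', hk'⟩
        exact (QueryOrder.MindChanges.of_RTT hL).mem_POneOne_of_even hj hj' hk hk'
      · exact (QueryOrder.MindChanges.of_RTT hL).mem_POneOne_of_odd hj' le_rfl hk
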